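/- Let $N\ge 1$, $\tau\ge 1$ be integers and $0<p\le 1$. An access point serves $N$ clients; time is divided into slots, and the slots $k\tau,\dots,(k+1)\tau-1$ form the $k$-th frame. At the beginning of each frame one packet is generated for each client; it is dropped at the end of the frame if it has not been delivered. In each slot the access point transmits one packet that is still undelivered in the current frame, or idles; a transmitted packet is delivered with probability $p$, independently over slots. A policy chooses the transmissions on the basis of the past transmissions and their outcomes and, possibly, of a random seed independent of the channel; it is non-idling if it transmits whenever an undelivered packet is left in the frame. For $q\in\mathbb R$ let $d_j(t)$ be $tq$ minus the number of packets delivered for client $j$ in the frames $0,\dots,t-1$, and let $\varphi(t)=\sqrt{2t\log\log t}$. The policy MWDF lists the clients at the beginning of each frame in decreasing order of $d_j(t)/p$ (ties broken arbitrarily) and serves them during the frame in that order, each one until its packet is delivered. Let $I=\frac1\tau E\big[(\tau-\sum_{i=1}^N\gamma_i)^+\big]$, where $\gamma_1,\dots,\gamma_N$ are independent geometric variables on $\{1,2,\dots\}$ with parameter $p$, and suppose that $$N\,\frac qp=\tau\,(1-I).$$ Then the standard deviation of $\sum_{j=1}^N\frac{d_j(t+1)-d_j(t)}{p}$ has the same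 value $\sigma_{p,\tau}$ for all $t\ge 0$ and all non-idling policies. MWDF policies exist, and every MWDF policy is non-idling and satisfies, almost surely, $$\limsup_{t\to\infty}\frac{d_j(t)}{p\,\varphi(t)}=\frac{\sigma_{p,\tau}}{N}\qquad\text{for every } j=1,\dots,N .$$ Moreover, let $\Pi$ be the class of the policies $\pi$ for which there are real constants $v_j^\pi,w_j^\pi$ such that, almost surely, for every $j$, $\limsup_t |d_j(t)|/(p\varphi(t))<\infty$, $\limsup_t d_j(t)/(p\varphi(t))=v_j^\pi$ and $\liminf_t d_j(t)/(p\varphi(t))=w_j^\pi$, and such that $\sum_j v_j^\pi=\sigma_{p,\tau}$ and $\sum_j w_j^\pi=-\sigma_{p,\tau}$. Then every MWDF policy belongs to $\Pi$ and attains the minimum $$\min_{\pi\in\Pi}\ \max_{j=1,\dots,N} v_j^\pi=\frac{\sigma_{p,\tau}}{N}.$$ -/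

import Mathlib

open MeasureTheory ProbabilityTheory Filter

namespace RealTimeScheduling

noncomputable section

/-- The law-of-the-iterated-logarithm scaling `φ(t) = √(2 t log log t)`. -/
def phi (t : ℕ) : ℝ := Real.sqrt (2 * t * Real.log (Real.log t))

/-- The expected proportion of idle time `I = (1/τ) E[(τ - ∑ γ_i)⁺]`, the `γ_i` (numbers of attempts
needed to deliver a packet) being `N` independent geometric variables on `{1, 2, …}`.
Mathlib's `geometricMeasure` counts the failures before the first success, so `γ_i = g i + 1`. -/
def idleFraction (N τ : ℕ) (p : unitInterval) : ℝ :=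
  (1 / (τ : ℝ)) * ∫ g : Fin N → ℕ, max ((τ : ℝ) - ∑ i, ((g i : ℝ) + 1)) 0
    ∂(Measure.pi fun _ : Fin N => geometricMeasure p)

/-- What happens in one slot: the client whose packet is transmitted (`none` if the access point
idles), and whether this packet is delivered. -/
abbrev SlotRecord (N : ℕ) : Type := Option (Fin N) × Bool

/-- The records of the slots so far, the most recent slot first. With frame length `τ`, the slots
`kτ, …, (k+1)τ - 1` form the `k`-th frame. -/
abbrev History (N : ℕ) : Type := List (SlotRecord N)

/-- The part of a history that precedes the current frame. -/
def frameStart {N : ℕ} (τ : ℕ) (h : History N) : History N := h.drop (h.length % τ)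

/-- The clients whose packet of the current frame has not been delivered yet. -/
def undelivered {N : ℕ} (τ : ℕ) (h : History N) : Finset (Fin N) :=
  Finset.univ.filter fun i => (some i, true) ∉ h.take (h.length % τ)

/-- For the history `h` at the beginning of frame `t = h.length / τ`, the debt owed to client `i`:
`t q` minus the number of packets delivered for client `i` in the frames `0, …, t - 1`. -/
def debt {N : ℕ} (τ : ℕ) (q : ℝ) (h : History N) (i : Fin N) : ℝ :=
  ((h.length / τ : ℕ) : ℝ) * q - (h.count (some i, true) : ℝ)

/-- A (possibly randomized) scheduling policy: in each slot, given the history and a random seed in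
`E`, it transmits a packet that is still undelivered in the current frame, or idles. -/
structure Policy (N τ : ℕ) (E : Type*) [MeasurableSpace E] where
  act : History N → E → Option (Fin N)
  measurableSet_act : ∀ h a, MeasurableSet {e | act h e = a}
  act_undelivered : ∀ h e i, act h e = some i → i ∈ undelivered τ h

namespace Policy

variable {N τ : ℕ} {E : Type*} [MeasurableSpace E]

/-- A policy is non-idling if it transmits whenever some packet of the frame is undelivered. -/
def NonIdling (π : Policy N τ E) : Prop :=
  ∀ h e, (undelivered τ h).Nonempty → π.act h e ≠ none

/-- The maximum weighted debt first policies: at the beginning of each frame the clients are listed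
in decreasing order of `d_i / p` (ties broken in any way), and during the frame they are
served in that order, each one until its packet is delivered. `order h e k` is the client in the
`k`-th place of the list that is made after the history `h`. -/
def IsMWDF (p q : ℝ) (π : Policy N τ E) : Prop :=
  ∃ order : History N → E → Equiv.Perm (Fin N), ∀ h e,
    Antitone (fun k => debt τ q (frameStart τ h) (order (frameStart τ h) e k) / p) ∧
    π.act h e =
      (List.ofFn (order (frameStart τ h) e)).find? fun i => decide (i ∈ undelivered τ h)

/-- The history before slot `n` under the policy with seed `e`, when `x m i` tells whether a
transmission to client `i` in slot `m` succeeds. -/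
def history (π : Policy N τ E) (e : E) (x : ℕ → Fin N → Bool) : ℕ → History N
  | 0 => []
  | n + 1 =>
    (π.act (π.history e x n) e, (π.act (π.history e x n) e).elim false (x n)) :: π.history e x n

variable {Ω : Type*}

/-- The debt `d_j(t)` of client `j` at the beginning of frame `t`, for the random seed `U` and the
channel states `X`. -/
def debtAt (π : Policy N τ E) (q : ℝ) (U : Ω → E) (X : ℕ → Ω → Fin N → Bool)
    (j : Fin N) (t : ℕ) (ω : Ω) : ℝ :=
  debt τ q (π.history (U ω) (fun n => X n ω) (t * τ)) j

/-- The scaled debt `d_j(t) / (p φ(t))`. -/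
def scaledDebt (π : Policy N τ E) (p q : ℝ) (U : Ω → E) (X : ℕ → Ω → Fin N → Bool)
    (j : Fin N) (t : ℕ) (ω : Ω) : ℝ :=
  1 / phi t * (π.debtAt q U X j t ω / p)

/-- The increment `∑_j (d_j(t+1) - d_j(t)) / p` in frame `t`. -/
def totalIncrement (π : Policy N τ E) (p q : ℝ) (U : Ω → E) (X : ℕ → Ω → Fin N → Bool)
    (t : ℕ) (ω : Ω) : ℝ :=
  ∑ j, (π.debtAt q U X j (t + 1) ω - π.debtAt q U X j t ω) / p

/-- The policy belongs to the class `Π` with constants `v_j` and `w_j`: almost surely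
`limsup |d_j(t)| / (p φ(t))` is finite, `limsup d_j(t) / (p φ(t)) = v_j` and
`liminf d_j(t) / (p φ(t)) = w_j`, where `∑ v_j = σ` and `∑ w_j = -σ`. The limits are taken in the
extended reals. -/
structure InClass [MeasurableSpace Ω] (P : Measure Ω) (π : Policy N τ E) (p q : ℝ) (U : Ω → E)
    (X : ℕ → Ω → Fin N → Bool) (σ : ℝ) (v w : Fin N → ℝ) : Prop where
  finite_limsup : ∀ j, ∀ᵐ ω ∂P,
    limsup (fun t => ((|π.scaledDebt p q U X j t ω| : ℝ) : EReal)) atTop < ⊤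
  limsup_eq : ∀ j, ∀ᵐ ω ∂P,
    limsup (fun t => ((π.scaledDebt p q U X j t ω : ℝ) : EReal)) atTop = ((v j : ℝ) : EReal)
  liminf_eq : ∀ j, ∀ᵐ ω ∂P,
    liminf (fun t => ((π.scaledDebt p q U X j t ω : ℝ) : EReal)) atTop = ((w j : ℝ) : EReal)
  sum_v : ∑ j, v j = σ
  sum_w : ∑ j, w j = -σ

/-- The costs `max_j v_j` of the policies of the class `Π`. -/
def costs [MeasurableSpace Ω] (P : Measure Ω) (N τ : ℕ) (p q : ℝ) (U : Ω → E)
    (X : ℕ → Ω → Fin N → Bool) (σ : ℝ) : Set ℝ :=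
  {c | ∃ (π : Policy N τ E) (v w : Fin N → ℝ), π.InClass P p q U X σ v w ∧ c = ⨆ j, v j}

end Policy

end

end RealTimeScheduling

/-! Give idle slots a fictitious trial. Then every slot has an outcome that succeeds with
probability `p` independently of the past, whatever the policy, and under a non-idling policy a
frame with `s` successes delivers exactly `min N s` packets. So the scaled total debt is a random
walk with bounded i.i.d. steps `(N q - min N s) / p`, `s` binomial, whose law does not depend on the
policy. Since `E min(N, s) = p E min(τ, ∑ γ_i)` (`binomialExp_min_eq`), the heavy-traffic equation
says that the steps are centered, and `σ` is their standard deviation. By the law of the iterated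
logarithm (`ae_iterated_logarithm`) the total oscillates between `-σ φ(t)` and `σ φ(t)`.

In the class `Π` the `v_j` add up to `σ`, so their maximum is at least `σ / N`
(`div_le_of_mem_costs`). Equality under MWDF comes from state space collapse
(`ae_eventually_debtDev_le`): all debts stay close to their mean. Let `V` be the sum of the squared
deviations from the mean. A frame with `0 < s < N` successes serves the `s` largest debts and lowers
`V` by a multiple of `√V`, up to a bounded error (`div_le_headSum`); all other frames leave `V`
unchanged. If frames of the first kind have positive probability, the drift of `V³` is bounded
above, so `E V(t)³ ≤ K t`, and Markov's inequality bounds `P(V(t) > ε t)` by a multiple of `t⁻²`.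
Borel–Cantelli gives `V(t) = o(t)`: each debt differs from the mean by `o(√t)`, which is negligible
against `φ(t)`.

The iterated logarithm is proved for bounded variables. The upper half uses a Chernoff maximal
inequality along geometric times. The lower half uses a moderate deviation bound, obtained from the
central limit theorem on many independent blocks, and the second Borel–Cantelli lemma. -/

namespace RealTimeScheduling

/-! ### Independence of partial sums, exponential moments and a maximal inequality -/

section IteratedLogarithm

variable {Ω : Type*} [MeasurableSpace Ω] {P : Measure Ω}

/-- Functions that are adapted to an increasing sequence of σ-algebras and independent of the
respective past are mutually independent. -/
lemma iIndepFun_of_indep_past [IsProbabilityMeasure P] {β : Type*} [MeasurableSpace β]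
    {f : ℕ → Ω → β} {F : ℕ → MeasurableSpace Ω} (hF : Monotone F)
    (hf : ∀ n, Measurable[F (n + 1)] (f n))
    (hfF : ∀ n, Indep (MeasurableSpace.comap (f n) inferInstance) (F n) P) :
    iIndepFun f P := by
  rw [iIndepFun_iff]
  intro s
  induction s using Finset.induction_on_max with
  | empty => simp
  | insert a s hs ih =>
    intro A hA
    have ha : a ∉ s := fun h => lt_irrefl _ (hs a h)
    rw [Finset.prod_insert ha, ← ih fun i hi => hA i (Finset.mem_insert_of_mem hi),
      Finset.set_biInter_insert]
    refine (Indep_iff _ _ _).1 (hfF a) _ _ (hA a (Finset.mem_insert_self _ _)) ?_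
    refine MeasurableSet.biInter s.countable_toSet fun i hi => ?_
    obtain ⟨B, hB, hBA⟩ := hA i (Finset.mem_insert_of_mem hi)
    rw [← hBA]
    exact hF (Nat.succ_le_of_lt (hs i hi)) _ (hf i hB)

/-- The σ-algebra generated by the first `n` members of a sequence. -/
abbrev pastSigma {Ω β : Type*} [MeasurableSpace β] (f : ℕ → Ω → β) (n : ℕ) : MeasurableSpace Ω :=
  ⨆ i ∈ {i | i < n}, MeasurableSpace.comap (f i) inferInstance

lemma pastSigma_mono {Ω β : Type*} [MeasurableSpace β] (f : ℕ → Ω → β) : Monotone (pastSigma f) :=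
  fun _ _ h => biSup_mono fun _ hi => lt_of_lt_of_le hi h

lemma pastSigma_le {β : Type*} [MeasurableSpace β] {f : ℕ → Ω → β} (hf : ∀ n, Measurable (f n))
    (n : ℕ) : pastSigma f n ≤ ‹MeasurableSpace Ω› :=
  iSup₂_le fun i _ => (hf i).comap_le

lemma measurable_pastSigma {Ω β : Type*} [MeasurableSpace β] (f : ℕ → Ω → β) {i n : ℕ} (h : i < n) :
    Measurable[pastSigma f n] (f i) :=
  Measurable.mono (comap_measurable (f i))
    (le_biSup (fun i => MeasurableSpace.comap (f i) inferInstance) h) le_rfl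

lemma measurable_sum_pastSigma {Ω : Type*} (f : ℕ → Ω → ℝ) {s : Finset ℕ} {n : ℕ}
    (h : ∀ i ∈ s, i < n) : Measurable[pastSigma f n] fun ω => ∑ i ∈ s, f i ω :=
  Finset.measurable_fun_sum (m := pastSigma f n) _ fun i hi => measurable_pastSigma f (h i hi)

lemma indep_sum_pastSigma {f : ℕ → Ω → ℝ} (hf : ∀ n, Measurable (f n)) (hi : iIndepFun f P)
    {s : Finset ℕ} {n : ℕ} (h : ∀ i ∈ s, n ≤ i) :
    Indep (MeasurableSpace.comap (fun ω => ∑ i ∈ s, f i ω) inferInstance) (pastSigma f n) P := by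
  have := indep_iSup_of_disjoint (S := {i | n ≤ i}) (T := {i | i < n})
    (fun k => (hf k).comap_le) hi
    (Set.disjoint_left.2 fun i h1 h2 => by simp at h1 h2; omega)
  refine indep_of_indep_of_le_left this (Measurable.comap_le ?_)
  refine Finset.measurable_fun_sum
    (m := ⨆ i ∈ {i | n ≤ i}, MeasurableSpace.comap (f i) inferInstance) _ fun i hi => ?_
  exact Measurable.mono (comap_measurable (f i))
    (le_biSup (fun i => MeasurableSpace.comap (f i) inferInstance) (h i hi)) le_rfl

lemma exp_le_of_abs_le_one {x : ℝ} (hx : |x| ≤ 1) :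
    Real.exp x ≤ 1 + x + x ^ 2 / 2 + |x| ^ 3 := by
  have h := (abs_le.1 (Real.exp_bound hx (n := 3) (by norm_num))).2
  norm_num [Finset.sum_range_succ, Nat.factorial] at h
  nlinarith [pow_nonneg (abs_nonneg x) 3]

variable [IsProbabilityMeasure P]

lemma integrable_of_abs_le {Y : Ω → ℝ} {B : ℝ} (hY : Measurable Y) (hB : ∀ ω, |Y ω| ≤ B) :
    Integrable Y P :=
  .of_bound hY.aestronglyMeasurable B (.of_forall hB)

lemma integrable_exp_mul_of_abs_le {Y : Ω → ℝ} {B : ℝ} (hY : Measurable Y)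
    (hB : ∀ ω, |Y ω| ≤ B) (l : ℝ) : Integrable (fun ω => Real.exp (l * Y ω)) P := by
  refine integrable_of_abs_le (B := Real.exp (|l| * B)) (by fun_prop) fun ω => ?_
  rw [Real.abs_exp, Real.exp_le_exp]
  calc l * Y ω ≤ |l * Y ω| := le_abs_self _
    _ = |l| * |Y ω| := abs_mul _ _
    _ ≤ |l| * B := by gcongr; exact hB ω

lemma one_le_mgf {Y : Ω → ℝ} {B : ℝ} (hY : Measurable Y) (hB : ∀ ω, |Y ω| ≤ B)
    (h0 : ∫ ω, Y ω ∂P = 0) (l : ℝ) : 1 ≤ mgf Y P l := by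
  have hi := integrable_of_abs_le (P := P) hY hB
  calc (1 : ℝ) = ∫ ω, (1 + l * Y ω) ∂P := by
        rw [integral_add (integrable_const _) (hi.const_mul l), integral_const_mul, h0]; simp
    _ ≤ ∫ ω, Real.exp (l * Y ω) ∂P :=
        integral_mono ((integrable_const _).add (hi.const_mul l))
          (integrable_exp_mul_of_abs_le hY hB l)
          fun ω => by simpa [add_comm] using Real.add_one_le_exp (l * Y ω)

/-- The moment generating function of a bounded centered variable is, near `0`, bounded by that of a
Gaussian variable of larger variance. -/
lemma exists_mgf_le {Y : Ω → ℝ} {B w : ℝ} (hY : Measurable Y) (hB : ∀ ω, |Y ω| ≤ B)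
    (h0 : ∫ ω, Y ω ∂P = 0) (hw : ∫ ω, Y ω ^ 2 ∂P < w) :
    ∃ l₀ > 0, ∀ l, 0 ≤ l → l ≤ l₀ → mgf Y P l ≤ Real.exp (l ^ 2 * w / 2) := by
  set C := max B 1
  have hC : 1 ≤ C := le_max_right _ _
  have hC0 : 0 < C := by linarith
  have hBC : ∀ ω, |Y ω| ≤ C := fun ω => (hB ω).trans (le_max_left _ _)
  set v := ∫ ω, Y ω ^ 2 ∂P
  -- The first bound gives `|l Y| ≤ 1`; the second makes the cubic remainder `l³ C³` fit into the
  -- gap `l² (w - v) / 2`.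
  refine ⟨min (1 / C) ((w - v) / (2 * C ^ 3)),
    lt_min (by positivity) (div_pos (by linarith) (by positivity)), fun l hl hl₀ => ?_⟩
  have h1 : l * C ≤ 1 := (le_div_iff₀ hC0).1 (hl₀.trans (min_le_left _ _))
  have h2 : l * (2 * C ^ 3) ≤ w - v :=
    (le_div_iff₀ (by positivity)).1 (hl₀.trans (min_le_right _ _))
  have hi := integrable_of_abs_le (P := P) hY hB
  have hi2 : Integrable (fun ω => Y ω ^ 2) P :=
    integrable_of_abs_le (B := C ^ 2) (by fun_prop) fun ω => by
      rw [abs_pow]; exact pow_le_pow_left₀ (abs_nonneg _) (hBC ω) 2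
  have hpt : ∀ ω, Real.exp (l * Y ω) ≤
      1 + l * Y ω + l ^ 2 / 2 * Y ω ^ 2 + l ^ 3 * C ^ 3 := fun ω => by
    have ha : |l * Y ω| ≤ l * C := by
      rw [abs_mul, abs_of_nonneg hl]; gcongr; exact hBC ω
    have := exp_le_of_abs_le_one (ha.trans h1)
    have h3 : |l * Y ω| ^ 3 ≤ (l * C) ^ 3 := pow_le_pow_left₀ (abs_nonneg _) ha 3
    nlinarith
  have hint : Integrable (fun ω => 1 + l * Y ω + l ^ 2 / 2 * Y ω ^ 2 + l ^ 3 * C ^ 3) P :=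
    (((integrable_const _).add (hi.const_mul l)).add (hi2.const_mul _)).add (integrable_const _)
  calc mgf Y P l ≤ ∫ ω, (1 + l * Y ω + l ^ 2 / 2 * Y ω ^ 2 + l ^ 3 * C ^ 3) ∂P :=
        integral_mono (integrable_exp_mul_of_abs_le hY hB l) hint hpt
    _ = 1 + l ^ 2 / 2 * v + l ^ 3 * C ^ 3 := by
        rw [integral_add (by fun_prop) (by fun_prop), integral_add (by fun_prop) (by fun_prop),
          integral_add (by fun_prop) (by fun_prop), integral_const_mul, integral_const_mul, h0]
        simp [v]
    _ ≤ l ^ 2 * w / 2 + 1 := by nlinarith [mul_le_mul_of_nonneg_left h2 (sq_nonneg l)]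
    _ ≤ _ := Real.add_one_le_exp _

variable {Z : ℕ → Ω → ℝ} {B : ℝ}

/-- Each step multiplies by a factor `exp (l Z_n)` that is independent of the past and has mean at
least `1`, by `exp x ≥ 1 + x` and centering. -/
lemma submartingale_exp_sum (hm : ∀ n, Measurable (Z n)) (hi : iIndepFun Z P)
    (hB : ∀ n ω, |Z n ω| ≤ B) (h0 : ∀ n, ∫ ω, Z n ω ∂P = 0) (l : ℝ) :
    Submartingale (fun n ω => Real.exp (l * ∑ i ∈ Finset.range n, Z i ω))
      ⟨pastSigma Z, pastSigma_mono Z, pastSigma_le hm⟩ P := by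
  have hS : ∀ n ω, |∑ i ∈ Finset.range n, Z i ω| ≤ n * B := fun n ω =>
    (Finset.abs_sum_le_sum_abs _ _).trans
      ((Finset.sum_le_sum fun i _ => hB i ω).trans (by simp))
  have hSm : ∀ n, Measurable fun ω => ∑ i ∈ Finset.range n, Z i ω := fun n =>
    Finset.measurable_fun_sum _ fun i _ => hm i
  have hpm : ∀ n, Measurable[pastSigma Z n]
      fun ω => Real.exp (l * ∑ i ∈ Finset.range n, Z i ω) := fun n =>
    Real.measurable_exp.comp ((measurable_sum_pastSigma Z (n := n) (by simp)).const_mul l)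
  refine submartingale_of_setIntegral_le_succ (fun n => (hpm n).stronglyMeasurable)
    (fun n => integrable_exp_mul_of_abs_le (hSm n) (hS n) l) fun n s hs => ?_
  have hs' : MeasurableSet s := pastSigma_le hm n _ hs
  have hind : IndepFun (s.indicator fun ω => Real.exp (l * ∑ i ∈ Finset.range n, Z i ω))
      (fun ω => Real.exp (l * Z n ω)) P := by
    have h1 := (indep_sum_pastSigma (P := P) hm hi (s := {n}) (n := n) (by simp)).symm
    simp only [Finset.sum_singleton] at h1
    refine indep_of_indep_of_le_left (indep_of_indep_of_le_right h1 ?_) ?_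
    · exact Measurable.comap_le (Real.measurable_exp.comp ((comap_measurable (Z n)).const_mul l))
    · exact Measurable.comap_le ((hpm n).indicator hs)
  rw [← integral_indicator hs', ← integral_indicator hs']
  have heq : (s.indicator fun ω => Real.exp (l * ∑ i ∈ Finset.range (n + 1), Z i ω)) =
      fun ω => (s.indicator fun ω => Real.exp (l * ∑ i ∈ Finset.range n, Z i ω)) ω *
        Real.exp (l * Z n ω) := by
    ext ω
    by_cases h : ω ∈ s <;> simp [h, Finset.sum_range_succ, mul_add, Real.exp_add]
  rw [heq, hind.integral_fun_mul_eq_mul_integral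
    (((integrable_exp_mul_of_abs_le (P := P) (hSm n) (hS n) l).indicator hs').aestronglyMeasurable)
    (integrable_exp_mul_of_abs_le (P := P) (hm n) (hB n) l).aestronglyMeasurable]
  refine le_mul_of_one_le_right (integral_nonneg fun ω => ?_)
    (one_le_mgf (hm n) (hB n) (h0 n) l)
  exact Set.indicator_nonneg (fun _ _ => (Real.exp_pos _).le) _

/-- A maximal inequality of Chernoff type. -/
lemma measure_exists_le_sum_le (hm : ∀ n, Measurable (Z n)) (hi : iIndepFun Z P)
    (hd : ∀ n, IdentDistrib (Z n) (Z 0) P P)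
    (hB : ∀ n ω, |Z n ω| ≤ B) (h0 : ∫ ω, Z 0 ω ∂P = 0) {l : ℝ} (hl : 0 ≤ l) (x : ℝ) (n : ℕ) :
    P {ω | ∃ k ≤ n, x ≤ ∑ i ∈ Finset.range k, Z i ω} ≤
      ENNReal.ofReal (Real.exp (-(l * x)) * mgf (Z 0) P l ^ n) := by
  have hsub := submartingale_exp_sum hm hi hB (fun n => (hd n).integral_eq.trans h0) l
  have hmax := maximal_ineq hsub (fun _ _ => (Real.exp_pos _).le)
    (ε := (Real.exp (l * x)).toNNReal) n
  rw [Real.coe_toNNReal _ (Real.exp_pos _).le] at hmax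
  set A := {ω | Real.exp (l * x) ≤
    (Finset.range (n + 1)).sup' Finset.nonempty_range_add_one
      fun k => Real.exp (l * ∑ i ∈ Finset.range k, Z i ω)} with hA
  have hsubset : {ω | ∃ k ≤ n, x ≤ ∑ i ∈ Finset.range k, Z i ω} ⊆ A := by
    rintro ω ⟨k, hk, hx⟩
    rw [hA, Set.mem_ofPred_eq, Finset.le_sup'_iff]
    exact ⟨k, by simpa using Nat.lt_succ_of_le hk,
      Real.exp_le_exp.2 (mul_le_mul_of_nonneg_left hx hl)⟩
  have hmgf : ∫ ω, Real.exp (l * ∑ i ∈ Finset.range n, Z i ω) ∂P = mgf (Z 0) P l ^ n := by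
    have := mgf_sum_of_identDistrib (s := Finset.range n) (j := 0) hm hi
      (fun i _ j _ => (hd i).trans (hd j).symm)
    -- The reference index `0` belongs to `range n` only for `n > 0`.
    rcases Nat.eq_zero_or_pos n with rfl | hn
    · simp
    · have := this (by simpa using hn) l
      simpa [mgf] using this
  have hE : ENNReal.ofReal (Real.exp (l * x)) * P A ≤
      ENNReal.ofReal (mgf (Z 0) P l ^ n) := by
    refine hmax.trans (ENNReal.ofReal_le_ofReal ?_)
    rw [← hmgf]
    exact setIntegral_le_integral (hsub.integrable n) (.of_forall fun _ => (Real.exp_pos _).le)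
  calc _ ≤ P A := measure_mono hsubset
    _ = ENNReal.ofReal (Real.exp (-(l * x))) * (ENNReal.ofReal (Real.exp (l * x)) * P A) := by
        rw [← mul_assoc, ← ENNReal.ofReal_mul (Real.exp_pos _).le, ← Real.exp_add]; simp
    _ ≤ ENNReal.ofReal (Real.exp (-(l * x))) * ENNReal.ofReal (mgf (Z 0) P l ^ n) := by gcongr
    _ = _ := by rw [← ENNReal.ofReal_mul (Real.exp_pos _).le]

end IteratedLogarithm

/-! ### Upper half of the law of the iterated logarithm -/

section IteratedLogarithmUpper

variable {Ω : Type*} [MeasurableSpace Ω] {P : Measure Ω}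

lemma ae_eventually_notMem_of_summable {A : ℕ → Set Ω} {a : ℕ → ℝ} (ha : Summable a)
    (ha0 : ∀ k, 0 ≤ a k) (h : ∀ᶠ k in atTop, P (A k) ≤ ENNReal.ofReal (a k)) :
    ∀ᵐ ω ∂P, ∀ᶠ k in atTop, ω ∉ A k := by
  obtain ⟨k₀, hk₀⟩ := eventually_atTop.1 h
  have hsum : ∑' k, P (A (k + k₀)) ≠ ⊤ := by
    refine ne_top_of_le_ne_top ?_
      (ENNReal.tsum_le_tsum fun k => hk₀ (k + k₀) (Nat.le_add_left _ _))
    rw [← ENNReal.ofReal_tsum_of_nonneg (fun _ => ha0 _) ((summable_nat_add_iff k₀).2 ha)]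
    exact ENNReal.ofReal_ne_top
  filter_upwards [ae_eventually_notMem hsum] with ω hω
  obtain ⟨K, hK⟩ := eventually_atTop.1 hω
  refine eventually_atTop.2 ⟨K + k₀, fun k hk => ?_⟩
  have := hK (k - k₀) (by omega)
  rwa [Nat.sub_add_cancel (by omega)] at this

lemma phi_nonneg (t : ℕ) : 0 ≤ phi t := Real.sqrt_nonneg _

lemma sqrt_le_phi_of_le {y : ℝ} {n : ℕ} (hy : 1 < y) (hyn : y ≤ n) :
    Real.sqrt (2 * y * Real.log (Real.log y)) ≤ phi n := by
  have h1 : Real.log (Real.log y) ≤ Real.log (Real.log n) :=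
    Real.log_le_log (Real.log_pos hy) (Real.log_le_log (by linarith) hyn)
  rcases le_total 0 (Real.log (Real.log y)) with h0 | h0
  · have : 0 ≤ Real.log (Real.log n) := h0.trans h1
    exact Real.sqrt_le_sqrt (by gcongr)
  -- `Real.sqrt` vanishes on nonpositive arguments, so small `y` need no separate hypothesis.
  · rw [Real.sqrt_eq_zero_of_nonpos (mul_nonpos_of_nonneg_of_nonpos (by linarith) h0)]
    exact phi_nonneg n

variable [IsProbabilityMeasure P] {Z : ℕ → Ω → ℝ} {B : ℝ}

/-- The upper half of the law of the iterated logarithm, for bounded variables. -/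
theorem ae_eventually_sum_le (hm : ∀ n, Measurable (Z n)) (hi : iIndepFun Z P)
    (hd : ∀ n, IdentDistrib (Z n) (Z 0) P P)
    (hB : ∀ n ω, |Z n ω| ≤ B) (h0 : ∫ ω, Z 0 ω ∂P = 0) {s : ℝ} (hs : 0 < s)
    (hvs : ∫ ω, Z 0 ω ^ 2 ∂P < s ^ 2) :
    ∀ᵐ ω ∂P, ∀ᶠ n in atTop, ∑ i ∈ Finset.range n, Z i ω ≤ s * phi n := by
  obtain ⟨w, hvw, hws⟩ := exists_between hvs
  have hw : 0 < w := lt_of_le_of_lt (integral_nonneg fun ω => sq_nonneg _) hvw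
  -- The ratio `r` of the time grid is so close to `1` that `r w` is the midpoint of `w` and `s²`.
  -- Hence the exponent `b = s² / (r w)` in the Borel–Cantelli series exceeds `1`.
  set r := (w + s ^ 2) / (2 * w) with hr_def
  have hr : 1 < r := by rw [hr_def, lt_div_iff₀ (by positivity)]; linarith
  have hr0 : 0 < r := by linarith
  set b := s ^ 2 / (r * w) with hb_def
  have hrw : r * w = (w + s ^ 2) / 2 := by rw [hr_def]; field_simp
  have hb : 1 < b := by rw [hb_def, lt_div_iff₀ (by positivity), hrw]; linarith
  have hlr : 0 < Real.log r := Real.log_pos hr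
  obtain ⟨l₀, hl₀, hmgf⟩ := exists_mgf_le (hm 0) (hB 0) h0 hvw
  -- `L k` is `log log r^k` and `x k` is `s φ` at the real time `r^k`; `l k` minimizes the Chernoff
  -- exponent `-l x + n l² w / 2` for `n = r^(k+1)`.
  set L : ℕ → ℝ := fun k => Real.log (k * Real.log r) with hL
  set x : ℕ → ℝ := fun k => s * Real.sqrt (2 * r ^ k * L k) with hx
  set l : ℕ → ℝ := fun k => x k / (r ^ (k + 1) * w) with hl
  have hLtop : Tendsto L atTop atTop :=
    Real.tendsto_log_atTop.comp (tendsto_natCast_atTop_atTop.atTop_mul_const hlr)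
  have hL0 : ∀ᶠ k in atTop, 0 ≤ L k := hLtop.eventually_ge_atTop 0
  -- The Gaussian bound on the moment generating function holds only for `l ≤ l₀`, so the optimal
  -- parameters have to tend to `0`.
  have hlt : Tendsto l atTop (nhds 0) := by
    have h1 : Tendsto (fun k : ℕ => (k : ℝ) * r⁻¹ ^ k) atTop (nhds 0) :=
      tendsto_self_mul_const_pow_of_lt_one (by positivity) (inv_lt_one_of_one_lt₀ hr)
    have h2 : Tendsto (fun k : ℕ => s / (r * w) * Real.sqrt (2 * Real.log r * (k * r⁻¹ ^ k)))
        atTop (nhds 0) := by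
      have := ((h1.const_mul (2 * Real.log r)).sqrt).const_mul (s / (r * w))
      simpa using this
    refine squeeze_zero' (.of_forall fun k => by positivity) ?_ h2
    filter_upwards [hL0, eventually_gt_atTop 0] with k hk hk0
    have hk0' : (0 : ℝ) < k := by exact_mod_cast hk0
    have hrk : 0 < r ^ k := by positivity
    have h3 : L k ≤ k * Real.log r :=
      (Real.log_le_sub_one_of_pos (by positivity)).trans (by linarith)
    have h4 : Real.sqrt (2 * r ^ k * L k) = r ^ k * Real.sqrt (2 * L k * r⁻¹ ^ k) := by
      rw [← Real.sqrt_sq hrk.le, ← Real.sqrt_mul (sq_nonneg _), Real.sqrt_sq hrk.le, inv_pow]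
      congr 1
      field_simp
    calc l k = s / (r * w) * Real.sqrt (2 * L k * r⁻¹ ^ k) := by
          simp only [hl, hx, h4]
          field_simp
          ring
      _ ≤ _ := by
          gcongr s / (r * w) * Real.sqrt ?_
          have : 0 ≤ r⁻¹ ^ k := by positivity
          nlinarith
  have hbound : ∀ᶠ k in atTop,
      P {ω | ∃ n ≤ ⌊r ^ (k + 1)⌋₊, x k ≤ ∑ i ∈ Finset.range n, Z i ω} ≤
        ENNReal.ofReal (((k * Real.log r) ^ b)⁻¹) := by
    filter_upwards [hL0, hlt.eventually_lt_const hl₀, eventually_gt_atTop 0] with k hk hlk hk0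
    have hk0' : (0 : ℝ) < k := by exact_mod_cast hk0
    have hl0 : 0 ≤ l k := by positivity
    refine (measure_exists_le_sum_le hm hi hd hB h0 hl0 (x k) _).trans
      (ENNReal.ofReal_le_ofReal ?_)
    have hxx : x k ^ 2 = s ^ 2 * (2 * r ^ k * L k) := by
      simp only [hx]
      rw [mul_pow, Real.sq_sqrt (by positivity)]
    calc Real.exp (-(l k * x k)) * mgf (Z 0) P (l k) ^ ⌊r ^ (k + 1)⌋₊
        ≤ Real.exp (-(l k * x k)) * Real.exp (l k ^ 2 * w / 2) ^ ⌊r ^ (k + 1)⌋₊ := by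
          gcongr
          · exact mgf_nonneg
          · exact hmgf _ hl0 hlk.le
      _ = Real.exp (-(l k * x k) + ⌊r ^ (k + 1)⌋₊ * (l k ^ 2 * w / 2)) := by
          rw [← Real.exp_nat_mul, Real.exp_add]
      _ ≤ Real.exp (-(l k * x k) + r ^ (k + 1) * (l k ^ 2 * w / 2)) := by
          gcongr
          exact Nat.floor_le (by positivity)
      _ = Real.exp (-(b * L k)) := by
          congr 1
          have : -(l k * x k) + r ^ (k + 1) * (l k ^ 2 * w / 2) =
              - (x k ^ 2 / (2 * r ^ (k + 1) * w)) := by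
            simp only [hl]
            field_simp
            ring
          rw [this, hxx, hb_def]
          field_simp
          ring
      _ = ((k * Real.log r) ^ b)⁻¹ := by
          rw [Real.exp_neg, Real.rpow_def_of_pos (by positivity), mul_comm]
  have hsum : Summable fun k : ℕ => (((k : ℝ) * Real.log r) ^ b)⁻¹ := by
    have := (Real.summable_nat_rpow_inv.2 hb).mul_right ((Real.log r ^ b)⁻¹)
    refine this.congr fun k => ?_
    rw [Real.mul_rpow (by positivity) hlr.le, mul_inv]
  filter_upwards [ae_eventually_notMem_of_summable hsum (fun k => by positivity) hbound] with ω hω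
  obtain ⟨K, hK⟩ := eventually_atTop.1 hω
  filter_upwards [eventually_ge_atTop ⌈r ^ (K + 1)⌉₊] with n hn
  have hn' : r ^ (K + 1) ≤ n := Nat.ceil_le.1 hn
  -- For `r^k ≤ n < r^(k+1)` the maximal event of block `k` controls the sum up to `n`, and its
  -- threshold `x k` is at most `s φ(n)`.
  obtain ⟨k, hk1, hk2⟩ := exists_nat_pow_near ((one_lt_pow₀ hr (by omega)).le.trans hn') hr
  have hkK : K + 1 ≤ k := by
    by_contra h
    have : r ^ (k + 1) ≤ r ^ (K + 1) := pow_le_pow_right₀ hr.le (by omega)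
    linarith
  have hnot := hK k (by omega)
  simp only [not_exists, not_and, not_le] at hnot
  refine (hnot n (Nat.le_floor hk2.le)).le.trans ?_
  have := sqrt_le_phi_of_le (one_lt_pow₀ hr (by omega)) hk1
  rw [Real.log_pow] at this
  exact mul_le_mul_of_nonneg_left this hs.le

end IteratedLogarithmUpper

/-! ### Moderate deviations and the lower half of the law of the iterated logarithm -/

section IteratedLogarithmLower

/-- On `(a, a + 1]` the density is at least `exp (-(a + 1)² / 2) / 3`. Passing to `a + 3` absorbs
the factor `3`; such a shift is harmless because `a` will be large when `s` is close to `σ`. The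
inequality is strict so that it survives a `liminf`. -/
lemma exp_lt_gaussianReal_Ioi {a : ℝ} (ha : 0 ≤ a) :
    ENNReal.ofReal (Real.exp (-(a + 3) ^ 2 / 2)) < gaussianReal 0 1 (Set.Ioi a) := by
  have h1 : ∀ x ∈ Set.Ioc a (a + 1),
      ENNReal.ofReal (1 / 3 * Real.exp (-(a + 1) ^ 2 / 2)) ≤ gaussianPDF 0 1 x := by
    rintro x ⟨hx1, hx2⟩
    refine ENNReal.ofReal_le_ofReal ?_
    rw [gaussianPDFReal]
    have h3 : Real.sqrt (2 * Real.pi * (1 : NNReal)) ≤ 3 := by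
      rw [Real.sqrt_le_left (by norm_num)]
      have := Real.pi_lt_four
      simp only [NNReal.coe_one, mul_one]
      linarith
    have h4 : 0 < Real.sqrt (2 * Real.pi * (1 : NNReal)) :=
      Real.sqrt_pos.2 (by simp [Real.pi_pos])
    rw [one_div]
    refine mul_le_mul (inv_anti₀ h4 h3) (Real.exp_le_exp.2 ?_) (Real.exp_pos _).le
      (inv_pos.2 h4).le
    simp only [NNReal.coe_one, sub_zero, mul_one]
    nlinarith
  have h2 : ENNReal.ofReal (1 / 3 * Real.exp (-(a + 1) ^ 2 / 2)) ≤
      gaussianReal 0 1 (Set.Ioi a) := by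
    calc ENNReal.ofReal (1 / 3 * Real.exp (-(a + 1) ^ 2 / 2))
        = ∫⁻ _ in Set.Ioc a (a + 1),
            ENNReal.ofReal (1 / 3 * Real.exp (-(a + 1) ^ 2 / 2)) := by simp
      _ ≤ ∫⁻ x in Set.Ioc a (a + 1), gaussianPDF 0 1 x :=
          setLIntegral_mono' measurableSet_Ioc h1
      _ = gaussianReal 0 1 (Set.Ioc a (a + 1)) := (gaussianReal_apply 0 one_ne_zero _).symm
      _ ≤ _ := measure_mono fun x hx => hx.1
  refine lt_of_lt_of_le ?_ h2
  rw [ENNReal.ofReal_lt_ofReal_iff (by positivity)]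
  have h5 : Real.exp (-(a + 1) ^ 2 / 2) =
      Real.exp (-(a + 3) ^ 2 / 2) * Real.exp (2 * a + 4) := by
    rw [← Real.exp_add]; ring_nf
  rw [h5]
  have h6 := Real.add_one_le_exp (2 * a + 4)
  have h7 := Real.exp_pos (-(a + 3) ^ 2 / 2)
  nlinarith

lemma identDistrib_sum_shift {Ω : Type*} [MeasurableSpace Ω] {P : Measure Ω} {Z : ℕ → Ω → ℝ}
    (hi : iIndepFun Z P)
    (hd : ∀ n, IdentDistrib (Z n) (Z 0) P P) (m b : ℕ) :
    IdentDistrib (fun ω => ∑ i ∈ Finset.Ico m (m + b), Z i ω)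
      (fun ω => ∑ i ∈ Finset.range b, Z i ω) P P := by
  have h := IdentDistrib.pi (X := fun i => Z (m + i)) (Y := Z)
    (fun i => (hd (m + i)).trans (hd i).symm) (hi.precomp (add_right_injective m)) hi
  have := h.comp (u := fun z : ℕ → ℝ => ∑ i ∈ Finset.range b, z i)
    (Finset.measurable_fun_sum _ fun i _ => measurable_pi_apply i)
  simpa [Function.comp_def, Finset.sum_Ico_eq_sum_range] using this

variable {Ω : Type*} [MeasurableSpace Ω] {P : Measure Ω} [IsProbabilityMeasure P]
  {Z : ℕ → Ω → ℝ} {B : ℝ} {σ : ℝ}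

/-- Central limit theorem, with the portmanteau inequality for the open half-line and the Gaussian
tail bound. -/
lemma eventually_exp_le_measureReal_sum_ge (hi : iIndepFun Z P)
    (hd : ∀ n, IdentDistrib (Z n) (Z 0) P P) (h0 : ∫ ω, Z 0 ω ∂P = 0) (hσ : 0 < σ)
    (hv : ∫ ω, Z 0 ω ^ 2 ∂P = σ ^ 2) {a : ℝ} (ha : 0 ≤ a) :
    ∀ᶠ b : ℕ in atTop, Real.exp (-(a + 3) ^ 2 / 2) ≤
      P.real {ω | a * σ * Real.sqrt b ≤ ∑ i ∈ Finset.range b, Z i ω} := by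
  have hlaw : HasLaw (id : ℝ → ℝ) (gaussianReal 0 1) (gaussianReal 0 1) :=
    ⟨aemeasurable_id, Measure.map_id⟩
  have hclt := tendstoInDistribution_inv_sqrt_mul_sum (P := P) (X := fun n ω => Z n ω / σ) hlaw
    (by simp [integral_div, h0])
    (by simp [div_pow, integral_div, hv, hσ.ne'])
    (hi.comp (fun _ x => x / σ) fun _ => by fun_prop)
    (fun n => (hd n).comp (u := fun x => x / σ) (by fun_prop))
  have hlim := ProbabilityMeasure.le_liminf_measure_open_of_tendsto hclt.tendsto
    (isOpen_Ioi (a := a))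
  simp only [ProbabilityMeasure.coe_mk, Measure.map_id] at hlim
  filter_upwards [eventually_lt_of_lt_liminf ((exp_lt_gaussianReal_Ioi ha).trans_le hlim),
    eventually_gt_atTop 0] with b hb hb0
  have hb0' : (0 : ℝ) < b := by exact_mod_cast hb0
  have hsb : 0 < Real.sqrt b := Real.sqrt_pos.2 hb0'
  rw [Measure.map_apply_of_aemeasurable (hclt.forall_aemeasurable b) measurableSet_Ioi] at hb
  refine ((ENNReal.ofReal_le_iff_le_toReal (measure_ne_top _ _)).1 hb.le).trans ?_
  refine measureReal_mono (fun ω hω => ?_)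
  simp only [Set.mem_preimage, Set.mem_Ioi, ← Finset.sum_div, Set.mem_ofPred_eq] at hω ⊢
  rw [← div_eq_inv_mul, div_div, lt_div_iff₀ (by positivity)] at hω
  linarith

/-- It suffices that each of `k` consecutive independent blocks of length `b` has a sum of at least
`x`. -/
lemma measureReal_sum_ge_pow_le (hm : ∀ n, Measurable (Z n)) (hi : iIndepFun Z P)
    (hd : ∀ n, IdentDistrib (Z n) (Z 0) P P) (x : ℝ) (b k : ℕ) :
    P.real {ω | x ≤ ∑ i ∈ Finset.range b, Z i ω} ^ k ≤
      P.real {ω | k * x ≤ ∑ i ∈ Finset.range (k * b), Z i ω} := by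
  induction k with
  | zero => simp
  | succ k ih =>
    have hind := (indep_sum_pastSigma (P := P) hm hi (s := Finset.Ico (k * b) (k * b + b))
      (n := k * b) (by simp; omega)).symm
    have h1 : MeasurableSet[pastSigma Z (k * b)]
        {ω | k * x ≤ ∑ i ∈ Finset.range (k * b), Z i ω} :=
      measurableSet_le measurable_const (measurable_sum_pastSigma Z (by simp))
    have h2 : MeasurableSet[MeasurableSpace.comap
        (fun ω => ∑ i ∈ Finset.Ico (k * b) (k * b + b), Z i ω) inferInstance]
        {ω | x ≤ ∑ i ∈ Finset.Ico (k * b) (k * b + b), Z i ω} :=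
      ⟨Set.Ici x, measurableSet_Ici, rfl⟩
    have h3 := (Indep_iff _ _ _).1 hind _ _ h1 h2
    have h4 : P {ω | x ≤ ∑ i ∈ Finset.Ico (k * b) (k * b + b), Z i ω} =
        P {ω | x ≤ ∑ i ∈ Finset.range b, Z i ω} :=
      (identDistrib_sum_shift hi hd (k * b) b).measure_mem_eq measurableSet_Ici
    calc _ ≤ P.real {ω | k * x ≤ ∑ i ∈ Finset.range (k * b), Z i ω} *
          P.real {ω | x ≤ ∑ i ∈ Finset.range b, Z i ω} := by
          rw [pow_succ]; gcongr
      _ = P.real ({ω | k * x ≤ ∑ i ∈ Finset.range (k * b), Z i ω} ∩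
          {ω | x ≤ ∑ i ∈ Finset.Ico (k * b) (k * b + b), Z i ω}) := by
          simp only [measureReal_def]
          rw [h3, h4, ENNReal.toReal_mul]
      _ ≤ _ := measureReal_mono fun ω hω => by
          simp only [Set.mem_inter_iff, Set.mem_ofPred_eq] at hω ⊢
          rw [Nat.succ_mul, ← Finset.sum_range_add_sum_Ico _ (Nat.le_add_right (k * b) b)]
          push_cast
          linarith [hω.1, hω.2]

/-- A lower bound for moderate deviations of the partial sums. -/
lemma exists_exp_le_measureReal_sum_ge (hm : ∀ n, Measurable (Z n)) (hi : iIndepFun Z P)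
    (hd : ∀ n, IdentDistrib (Z n) (Z 0) P P) (h0 : ∫ ω, Z 0 ω ∂P = 0)
    (hv : ∫ ω, Z 0 ω ^ 2 ∂P = σ ^ 2) {s : ℝ} (hs : 0 < s) (hsσ : s < σ) :
    ∃ β C y₀ : ℝ, 0 < β ∧ β < 1 ∧ 0 < C ∧ ∀ y, y₀ ≤ y → ∀ m : ℕ, C * y ≤ m →
      ∃ m' ≤ m, Real.exp (-(β * y)) ≤
        P.real {ω | s * Real.sqrt (2 * m * y) ≤ ∑ i ∈ Finset.range m', Z i ω} := by
  have hσ : 0 < σ := hs.trans hsσ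
  set θ := s ^ 2 / σ ^ 2 with hθ
  have hθ0 : 0 < θ := by positivity
  have hθ1 : θ < 1 := by rw [hθ, div_lt_one (by positivity)]; gcongr
  -- The loss factor `t < 1` is spent three times, whence `θ < t³`: twice for the square of `a / (a
  -- + 3)` and once for rounding the block length.
  set t := (3 + θ) / 4 with ht
  have ht0 : 0 < t := by positivity
  have ht1 : t < 1 := by rw [ht]; linarith
  have ht3 : θ < t ^ 3 := by
    have : t ^ 3 - θ = (1 - θ) * ((1 - θ) ^ 2 * (-1) / 64 + 12 * (1 - θ) / 64 + 16 / 64) := by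
      rw [ht]; ring
    have h1 : 0 < (1 - θ) * ((1 - θ) ^ 2 * (-1) / 64 + 12 * (1 - θ) / 64 + 16 / 64) :=
      mul_pos (by linarith) (by nlinarith [sq_nonneg (1 - θ)])
    linarith
  set a := 3 * t / (1 - t) with ha
  have ha0 : 0 < a := div_pos (by positivity) (by linarith)
  have hat : (a + 3) * t = a := by
    rw [ha]; have : (1 - t) ≠ 0 := by linarith
    field_simp; ring
  -- About `c y` blocks of length `b`, with total length at least `t m` and each with sum at least
  -- `a σ √b`, together just reach `s √(2 m y)`. As `(a + 3) t = a`, their cost per unit of `y` is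
  -- `c (a + 3)² / 2 = θ / t³ < 1`.
  set c := 2 * θ / (t * a ^ 2) with hc
  have hc0 : 0 < c := by positivity
  have hcθ : c * (a + 3) ^ 2 / 2 < 1 := by
    have h1 : c * (a + 3) ^ 2 / 2 = θ / t ^ 3 := by
      rw [hc]; nth_rw 1 [← hat]
      field_simp
    rw [h1, div_lt_one (by positivity)]
    exact ht3
  obtain ⟨β, hβ1, hβ2⟩ := exists_between hcθ
  obtain ⟨b₀, hb₀⟩ :=
    eventually_atTop.1 (eventually_exp_le_measureReal_sum_ge hi hd h0 hσ hv ha0.le)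
  -- `C` forces `k ≤ (1 - t) m`, so that rounding leaves `k b ≥ t m`, and `k b₀ ≤ t m`, so that `b ≥
  -- b₀`. From `y₀` on, the gap between `β` and `c (a + 3)² / 2` absorbs the `+ 1` in `k ≤ c y + 1`.
  refine ⟨β, (c + 1) * (b₀ / t + 1 / (1 - t)),
    max 1 ((a + 3) ^ 2 / 2 / (β - c * (a + 3) ^ 2 / 2)), lt_of_le_of_lt (by positivity) hβ1,
    hβ2, mul_pos (by linarith) (add_pos_of_nonneg_of_pos (by positivity)
      (one_div_pos.2 (by linarith))), fun y hy m hym => ?_⟩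
  have hy1 : 1 ≤ y := (le_max_left _ _).trans hy
  have hy2 : (a + 3) ^ 2 / 2 ≤ y * (β - c * (a + 3) ^ 2 / 2) :=
    (div_le_iff₀ (by linarith)).1 ((le_max_right _ _).trans hy)
  set k := ⌈c * y⌉₊ with hk
  have hk1 : c * y ≤ k := Nat.le_ceil _
  have hk2 : (k : ℝ) ≤ c * y + 1 := (Nat.ceil_lt_add_one (by positivity)).le
  have hk3 : (k : ℝ) ≤ (c + 1) * y := by linarith
  have hk0 : 0 < (k : ℝ) := lt_of_lt_of_le (by positivity) hk1
  have hk0' : 0 < k := by exact_mod_cast hk0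
  have hmk1 : (k : ℝ) ≤ (1 - t) * m := by
    have h1 : (c + 1) * y * (1 / (1 - t)) ≤ m := by
      refine le_trans ?_ hym
      have : 0 ≤ (c + 1) * y * (b₀ / t) := by positivity
      nlinarith
    rw [mul_one_div, div_le_iff₀ (by linarith)] at h1
    linarith
  have hmk2 : (k : ℝ) * b₀ ≤ t * m := by
    have h1 : (c + 1) * y * (b₀ / t) ≤ m := by
      refine le_trans ?_ hym
      have : 0 ≤ (c + 1) * y * (1 / (1 - t)) :=
        mul_nonneg (by positivity) (one_div_nonneg.2 (by linarith))
      nlinarith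
    rw [mul_div_assoc', div_le_iff₀ ht0] at h1
    have : (k : ℝ) * b₀ ≤ (c + 1) * y * b₀ := by gcongr
    linarith
  set b := m / k with hb
  have hb1 : t * m ≤ k * b := by
    have : m < k * (b + 1) := by
      rw [hb, mul_comm]; exact Nat.lt_mul_of_div_lt (Nat.lt_succ_self _) hk0'
    have : (m : ℝ) < k * (b + 1) := by exact_mod_cast this
    linarith
  have hb2 : b₀ ≤ b := by
    have : (b₀ : ℝ) ≤ b := le_of_mul_le_mul_left (hmk2.trans hb1) hk0
    exact_mod_cast this
  refine ⟨k * b, Nat.mul_div_le m k, ?_⟩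
  have hlev : s * Real.sqrt (2 * m * y) ≤ k * (a * σ * Real.sqrt b) := by
    have h1 : 2 * θ = c * (t * a ^ 2) := by rw [hc]; field_simp
    have h2 : s ^ 2 = θ * σ ^ 2 := by rw [hθ]; field_simp
    refine abs_le_of_sq_le_sq' ?_ (by positivity) |>.2
    rw [mul_pow, mul_pow, mul_pow, mul_pow, Real.sq_sqrt (by positivity),
      Real.sq_sqrt (by positivity)]
    calc s ^ 2 * (2 * m * y) = (2 * θ) * σ ^ 2 * m * y := by rw [h2]; ring
      _ = (c * y) * (a ^ 2 * σ ^ 2) * (t * m) := by rw [h1]; ring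
      _ ≤ k * (a ^ 2 * σ ^ 2) * (k * b) := by gcongr
      _ = _ := by ring
  calc Real.exp (-(β * y)) ≤ Real.exp (-(a + 3) ^ 2 / 2) ^ k := by
        rw [← Real.exp_nat_mul, Real.exp_le_exp]
        have : k * ((a + 3) ^ 2 / 2) ≤ (c * y + 1) * ((a + 3) ^ 2 / 2) := by gcongr
        nlinarith
    _ ≤ P.real {ω | a * σ * Real.sqrt b ≤ ∑ i ∈ Finset.range b, Z i ω} ^ k := by
        gcongr
        exact hb₀ b hb2
    _ ≤ P.real {ω | k * (a * σ * Real.sqrt b) ≤ ∑ i ∈ Finset.range (k * b), Z i ω} :=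
        measureReal_sum_ge_pow_le hm hi hd _ b k
    _ ≤ _ := measureReal_mono fun ω hω => hlev.trans hω

lemma phi_le_sqrt_of_le {y : ℝ} {n : ℕ} (hn : 1 < n) (hyn : n ≤ y)
    (h0 : 0 ≤ Real.log (Real.log y)) :
    phi n ≤ Real.sqrt (2 * y * Real.log (Real.log y)) := by
  have hn' : (1 : ℝ) < n := by exact_mod_cast hn
  have h1 : Real.log (Real.log n) ≤ Real.log (Real.log y) :=
    Real.log_le_log (Real.log_pos hn') (Real.log_le_log (by linarith) hyn)
  refine Real.sqrt_le_sqrt ?_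
  calc 2 * (n : ℝ) * Real.log (Real.log n) ≤ 2 * n * Real.log (Real.log y) := by gcongr
    _ ≤ _ := by gcongr

/-- The lower half of the law of the iterated logarithm, for bounded variables. -/
theorem ae_frequently_le_sum (hm : ∀ n, Measurable (Z n)) (hi : iIndepFun Z P)
    (hd : ∀ n, IdentDistrib (Z n) (Z 0) P P)
    (hB : ∀ n ω, |Z n ω| ≤ B) (h0 : ∫ ω, Z 0 ω ∂P = 0)
    (hv : ∫ ω, Z 0 ω ^ 2 ∂P = σ ^ 2) {s : ℝ} (hs : 0 < s) (hsσ : s < σ) :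
    ∀ᵐ ω ∂P, ∃ᶠ n in atTop, s * phi n ≤ ∑ i ∈ Finset.range n, Z i ω := by
  have hσ : 0 < σ := hs.trans hsσ
  obtain ⟨u, hsu, huσ⟩ := exists_between hsσ
  have hu : 0 < u := hs.trans hsu
  -- For a large grid ratio `K`, the block from `K^j` to `K^(j+1)` has nearly the full length, and
  -- the sum up to `K^j`, of size at most `2 σ φ(K^j)`, is negligible.
  obtain ⟨K, hK2, hK⟩ : ∃ K : ℕ, 2 ≤ K ∧
      s < u * Real.sqrt (1 - (K : ℝ)⁻¹) - 2 * σ * Real.sqrt ((K : ℝ)⁻¹) := by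
    have h1 : Tendsto (fun K : ℕ => (K : ℝ)⁻¹) atTop (nhds 0) := tendsto_inv_atTop_nhds_zero_nat
    have h2 : Tendsto (fun K : ℕ => u * Real.sqrt (1 - (K : ℝ)⁻¹) -
        2 * σ * Real.sqrt ((K : ℝ)⁻¹)) atTop
        (nhds (u * Real.sqrt (1 - 0) - 2 * σ * Real.sqrt 0)) :=
      ((h1.const_sub 1).sqrt.const_mul u).sub (h1.sqrt.const_mul (2 * σ))
    simp only [sub_zero, Real.sqrt_one, mul_one, Real.sqrt_zero, mul_zero] at h2
    exact ((eventually_ge_atTop 2).and (h2.eventually_const_lt hsu)).exists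
  have hKr : (2 : ℝ) ≤ K := by exact_mod_cast hK2
  have hK0 : (0 : ℝ) < K := by linarith
  have hlK : 0 < Real.log K := Real.log_pos (by linarith)
  obtain ⟨β, C, y₀, hβ0, hβ1, hC, hdev⟩ :=
    exists_exp_le_measureReal_sum_ge hm hi hd h0 hv hu huσ
  set y : ℕ → ℝ := fun j => Real.log ((j + 1 : ℕ) * Real.log K) with hy
  have hytop : Tendsto y atTop atTop :=
    Real.tendsto_log_atTop.comp
      ((tendsto_natCast_atTop_atTop.comp (tendsto_add_atTop_nat 1)).atTop_mul_const hlK)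
  have hCy : ∀ᶠ j in atTop, C * y j ≤ (K ^ (j + 1) - K ^ j : ℕ) := by
    have h1 : Tendsto (fun j : ℕ => ((j + 1 : ℕ) : ℝ) * (K : ℝ)⁻¹ ^ (j + 1)) atTop (nhds 0) :=
      (tendsto_self_mul_const_pow_of_lt_one (by positivity)
        (inv_lt_one_of_one_lt₀ (by linarith))).comp (tendsto_add_atTop_nat 1)
    filter_upwards [(h1.const_mul (C * Real.log K * K)).eventually_lt_const
      (by simp : C * Real.log K * K * 0 < 1)] with j hj
    have hKj : (0 : ℝ) < K ^ j := by positivity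
    have h2 : y j ≤ (j + 1 : ℕ) * Real.log K :=
      (Real.log_le_sub_one_of_pos (by positivity)).trans (by linarith)
    have h3 : C * ((j + 1 : ℕ) * Real.log K) ≤ K ^ j := by
      have : C * Real.log K * K * ((j + 1 : ℕ) * (K : ℝ)⁻¹ ^ (j + 1)) =
          C * ((j + 1 : ℕ) * Real.log K) / K ^ j := by
        rw [inv_pow, pow_succ]; field_simp
      rw [this, div_lt_one hKj] at hj
      exact hj.le
    have h4 : (K : ℝ) ^ j ≤ (K ^ (j + 1) - K ^ j : ℕ) := by
      have : K ^ j ≤ K ^ (j + 1) - K ^ j := by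
        rw [pow_succ]
        have : K ^ j * 2 ≤ K ^ j * K := by gcongr
        omega
      exact_mod_cast this
    calc C * y j ≤ C * ((j + 1 : ℕ) * Real.log K) := by gcongr
      _ ≤ _ := h3.trans h4
  obtain ⟨j₀, hj₀⟩ := eventually_atTop.1 (hCy.and (hytop.eventually_ge_atTop y₀))
  -- Below `j₀` the dummy length `0` is used, so that the blocks are defined for all `j`.
  have hex : ∀ j, ∃ m' ≤ K ^ (j + 1) - K ^ j, j₀ ≤ j → Real.exp (-(β * y j)) ≤
      P.real {ω | u * Real.sqrt (2 * (K ^ (j + 1) - K ^ j : ℕ) * y j) ≤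
        ∑ i ∈ Finset.range m', Z i ω} := fun j => by
    by_cases hj : j₀ ≤ j
    · obtain ⟨m', h1, h2⟩ := hdev (y j) (hj₀ j hj).2 _ (hj₀ j hj).1
      exact ⟨m', h1, fun _ => h2⟩
    · exact ⟨0, Nat.zero_le _, fun h => absurd h hj⟩
  choose m' hm'1 hm'2 using hex
  set T : ℕ → Ω → ℝ := fun j ω => ∑ i ∈ Finset.Ico (K ^ j) (K ^ j + m' j), Z i ω with hT
  set A : ℕ → Set Ω := fun j =>
    T j ⁻¹' Set.Ici (u * Real.sqrt (2 * (K ^ (j + 1) - K ^ j : ℕ) * y j)) with hA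
  have hTm : ∀ j, Measurable (T j) := fun j => Finset.measurable_fun_sum _ fun i _ => hm i
  have hpow : ∀ j, K ^ j + m' j ≤ K ^ (j + 1) := fun j => by
    have := hm'1 j
    have : K ^ j ≤ K ^ (j + 1) := Nat.pow_le_pow_right (by omega) (by omega)
    omega
  have hTi : iIndepFun T P := by
    refine iIndepFun_of_indep_past (F := fun j => pastSigma Z (K ^ j))
      (fun i j hij => pastSigma_mono Z (Nat.pow_le_pow_right (by omega) hij)) (fun j => ?_)
      fun j => ?_
    · refine measurable_sum_pastSigma Z fun i hi => ?_
      have := (Finset.mem_Ico.1 hi).2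
      have := hpow j
      omega
    · exact indep_sum_pastSigma hm hi fun i hi => (Finset.mem_Ico.1 hi).1
  have hAi : iIndepSet A P := by
    rw [iIndepSet_iff_meas_biInter fun j => hTm j measurableSet_Ici]
    intro S
    exact hTi.meas_biInter fun j _ => ⟨_, measurableSet_Ici, rfl⟩
  -- `exp (-(β y j))` is a constant multiple of `(j + 1)^(-β)`, which is not summable because `β <
  -- 1`.
  have hAsum : ∑' j, P (A j) = ⊤ := by
    by_contra hne
    have hsum : Summable fun j => P.real (A j) := ENNReal.summable_toReal hne
    have h1 : Summable fun j : ℕ => (((j + 1 : ℕ) * Real.log K) ^ β)⁻¹ := by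
      refine Summable.of_norm_bounded_eventually_nat hsum ?_
      filter_upwards [eventually_ge_atTop j₀] with j hj
      have hpos : 0 < ((j + 1 : ℕ) : ℝ) * Real.log K := by positivity
      rw [Real.norm_of_nonneg (by positivity), Real.rpow_def_of_pos hpos, ← Real.exp_neg,
        mul_comm]
      refine (hm'2 j hj).trans (le_of_eq ?_)
      exact congrArg ENNReal.toReal
        ((identDistrib_sum_shift hi hd (K ^ j) (m' j)).measure_mem_eq measurableSet_Ici).symm
    have h2 : Summable fun j : ℕ => ((j : ℝ) ^ β)⁻¹ := by
      rw [← summable_nat_add_iff 1]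
      refine (h1.mul_left (Real.log K ^ β)).congr fun j => ?_
      rw [Real.mul_rpow (by positivity) hlK.le]
      have : 0 < Real.log K ^ β := by positivity
      field_simp
    exact absurd (Real.summable_nat_rpow_inv.1 h2) (not_lt.2 hβ1.le)
  have hfreq : ∀ᵐ ω ∂P, ∃ᶠ j in atTop, ω ∈ A j := by
    have h1 := measure_limsup_eq_one (fun j => hTm j measurableSet_Ici) hAi hAsum
    have h2 : ∀ᵐ ω ∂P, ω ∈ limsup A atTop :=
      (prob_compl_eq_zero_iff (MeasurableSet.measurableSet_limsup
        fun j => hTm j measurableSet_Ici)).2 h1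
    filter_upwards [h2] with ω hω
    exact mem_limsup_iff_frequently_mem.1 hω
  -- The upper half for `-Z` bounds the sum before the block from below; any constant above `σ`
  -- would do.
  have hupper := ae_eventually_sum_le (P := P) (Z := fun n ω => -Z n ω) (s := 2 * σ)
    (fun n => (hm n).neg) (hi.comp (fun _ x => -x) fun _ => measurable_neg)
    (fun n => (hd n).comp measurable_neg) (fun n ω => by rw [abs_neg]; exact hB n ω)
    (by rw [integral_neg, h0, neg_zero]) (by positivity) (by simp only [neg_sq, hv]; nlinarith)
  filter_upwards [hfreq, hupper] with ω hω1 hω2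
  rw [frequently_atTop]
  intro n₀
  obtain ⟨n₁, hn₁⟩ := eventually_atTop.1 hω2
  obtain ⟨j, hjA, hj1, hj2⟩ := (hω1.and_eventually
    ((eventually_ge_atTop (max (max n₀ n₁) 1)).and (hytop.eventually_ge_atTop 0))).exists
  have hjK : j < K ^ j := Nat.lt_pow_self (by omega)
  refine ⟨K ^ j + m' j, by omega, ?_⟩
  have hM : (K : ℝ) ^ (j + 1) = K * K ^ j := by ring
  have hylog : y j = Real.log (Real.log ((K : ℝ) ^ (j + 1))) := by rw [Real.log_pow]
  set R := Real.sqrt (2 * (K : ℝ) ^ (j + 1) * y j) with hR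
  have hR0 : 0 ≤ R := Real.sqrt_nonneg _
  have hφ1 : phi (K ^ j + m' j) ≤ R := by
    rw [hR, hylog]
    exact phi_le_sqrt_of_le (by omega) (by exact_mod_cast hpow j) (hylog ▸ hj2)
  have hφ2 : phi (K ^ j) ≤ Real.sqrt ((K : ℝ)⁻¹) * R := by
    have h1 : phi (K ^ j) ≤ Real.sqrt (2 * (K : ℝ) ^ j * y j) := by
      refine Real.sqrt_le_sqrt ?_
      push_cast
      gcongr
      rw [hylog]
      have h2 : (1 : ℝ) < K ^ j := one_lt_pow₀ (by linarith) (by omega)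
      exact Real.log_le_log (Real.log_pos h2)
        (Real.log_le_log (by positivity) (pow_le_pow_right₀ (by linarith) (by omega)))
    refine h1.trans (le_of_eq ?_)
    rw [hR, ← Real.sqrt_mul (by positivity), hM]
    congr 1
    field_simp
  have hT1 : u * (Real.sqrt (1 - (K : ℝ)⁻¹) * R) ≤ T j ω := by
    refine le_trans (le_of_eq ?_) (Set.mem_Ici.1 hjA)
    have h1 : (K : ℝ)⁻¹ ≤ 1 := inv_le_one_of_one_le₀ (by linarith)
    rw [hR, ← Real.sqrt_mul (by linarith),
      Nat.cast_sub (Nat.pow_le_pow_right (by omega) (by omega))]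
    push_cast
    congr 2
    rw [hM]
    field_simp
  have hS : -(2 * σ * phi (K ^ j)) ≤ ∑ i ∈ Finset.range (K ^ j), Z i ω := by
    have := hn₁ (K ^ j) (by omega)
    rw [Finset.sum_neg_distrib] at this
    linarith
  rw [← Finset.sum_range_add_sum_Ico _ (Nat.le_add_right (K ^ j) (m' j))]
  have h5 : s * phi (K ^ j + m' j) ≤ s * R := by gcongr
  have h6 : 2 * σ * phi (K ^ j) ≤ 2 * σ * (Real.sqrt ((K : ℝ)⁻¹) * R) := by gcongr
  have h7 : s * R ≤ (u * Real.sqrt (1 - (K : ℝ)⁻¹) - 2 * σ * Real.sqrt ((K : ℝ)⁻¹)) * R := by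
    gcongr
  have h8 : T j ω = ∑ i ∈ Finset.Ico (K ^ j) (K ^ j + m' j), Z i ω := rfl
  linarith

end IteratedLogarithmLower

/-! ### The law of the iterated logarithm, both signs -/

section IteratedLogarithmFinal

variable {Ω : Type*} [MeasurableSpace Ω] {P : Measure Ω} [IsProbabilityMeasure P]
  {Z : ℕ → Ω → ℝ} {B : ℝ} {σ : ℝ}

/-- The law of the iterated logarithm for bounded variables. -/
theorem ae_iterated_logarithm (hm : ∀ n, Measurable (Z n)) (hi : iIndepFun Z P)
    (hd : ∀ n, IdentDistrib (Z n) (Z 0) P P)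
    (hB : ∀ n ω, |Z n ω| ≤ B) (h0 : ∫ ω, Z 0 ω ∂P = 0)
    (hσ : 0 ≤ σ) (hv : ∫ ω, Z 0 ω ^ 2 ∂P = σ ^ 2) :
    ∀ᵐ ω ∂P, ∀ ε > 0,
      (∀ᶠ n in atTop, ∑ i ∈ Finset.range n, Z i ω ≤ (σ + ε) * phi n) ∧
      (∀ᶠ n in atTop, -((σ + ε) * phi n) ≤ ∑ i ∈ Finset.range n, Z i ω) ∧
      (∃ᶠ n in atTop, (σ - ε) * phi n ≤ ∑ i ∈ Finset.range n, Z i ω) ∧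
      (∃ᶠ n in atTop, ∑ i ∈ Finset.range n, Z i ω ≤ -((σ - ε) * phi n)) := by
  -- The countably many values `ε = 1 / (k + 1)` give one null set for all `ε`.
  have key : ∀ W : ℕ → Ω → ℝ, (∀ n, Measurable (W n)) → iIndepFun W P →
      (∀ n, IdentDistrib (W n) (W 0) P P) → (∀ n ω, |W n ω| ≤ B) → ∫ ω, W 0 ω ∂P = 0 →
      ∫ ω, W 0 ω ^ 2 ∂P = σ ^ 2 → ∀ᵐ ω ∂P, ∀ k : ℕ,
        (∀ᶠ n in atTop, ∑ i ∈ Finset.range n, W i ω ≤ (σ + 1 / (k + 1)) * phi n) ∧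
        (0 < σ - 1 / ((k : ℝ) + 1) →
          ∃ᶠ n in atTop, (σ - 1 / (k + 1)) * phi n ≤ ∑ i ∈ Finset.range n, W i ω) := by
    intro W hm hi hd hB h0 hv
    rw [ae_all_iff]
    intro k
    have hk : 0 < 1 / ((k : ℝ) + 1) := Nat.one_div_pos_of_nat
    refine (ae_eventually_sum_le hm hi hd hB h0 (by positivity)
      (by rw [hv]; gcongr; linarith)).and ?_
    by_cases hs : 0 < σ - 1 / ((k : ℝ) + 1)
    · filter_upwards [ae_frequently_le_sum hm hi hd hB h0 hv hs (by linarith)] with ω hω _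
      exact hω
    · exact .of_forall fun ω h => absurd h hs
  have h1 := key Z hm hi hd hB h0 hv
  have h2 := key (fun n ω => -Z n ω)
    (fun n => (hm n).neg) (hi.comp (fun _ x => -x) fun _ => measurable_neg)
    (fun n => (hd n).comp measurable_neg) (fun n ω => by rw [abs_neg]; exact hB n ω)
    (by rw [integral_neg, h0, neg_zero]) (by simp only [neg_sq, hv])
  filter_upwards [h1, h2] with ω hω1 hω2 ε hε
  simp only [Finset.sum_neg_distrib] at hω2
  have hup : ∀ {w : ℕ → ℝ}, (∀ k : ℕ, ∀ᶠ n in atTop, w n ≤ (σ + 1 / (k + 1)) * phi n) →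
      ∀ δ > 0, ∀ᶠ n in atTop, w n ≤ (σ + δ) * phi n := by
    intro w hw δ hδ
    obtain ⟨k, hk⟩ := exists_nat_one_div_lt hδ
    filter_upwards [hw k] with n hn
    exact hn.trans (mul_le_mul_of_nonneg_right (by linarith) (phi_nonneg n))
  have hlow : ∀ {w : ℕ → ℝ},
      (∀ k : ℕ, 0 < σ - 1 / ((k : ℝ) + 1) → ∃ᶠ n in atTop, (σ - 1 / (k + 1)) * phi n ≤ w n) →
      (∀ δ > 0, ∀ᶠ n in atTop, -((σ + δ) * phi n) ≤ w n) →
      ∃ᶠ n in atTop, (σ - ε) * phi n ≤ w n := by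
    intro w hw hw'
    -- For `σ = 0` no positive level below `σ` exists, but the eventual lower bound `-ε φ` is
    -- already what is wanted.
    rcases hσ.eq_or_lt with h | h
    · refine (hw' ε hε).frequently.mono fun n hn => ?_
      rw [← h] at hn ⊢
      linarith
    · obtain ⟨k, hk⟩ := exists_nat_one_div_lt (lt_min hε h)
      refine (hw k (by linarith [min_le_right ε σ])).mono fun n hn => le_trans ?_ hn
      exact mul_le_mul_of_nonneg_right (by linarith [min_le_left ε σ]) (phi_nonneg n)
  have hu1 := hup fun k => (hω1 k).1
  have hu2 := hup fun k => (hω2 k).1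
  refine ⟨hu1 ε hε, (hu2 ε hε).mono fun n hn => by linarith,
    hlow (fun k => (hω1 k).2) fun δ hδ => (hu2 δ hδ).mono fun n hn => by linarith,
    (hlow (fun k => (hω2 k).2) fun δ hδ => (hu1 δ hδ).mono fun n hn => by linarith).mono
      fun n hn => by linarith⟩

end IteratedLogarithmFinal

/-! ### Frames along a single path: deliveries and successes -/

section Pathwise

variable {N τ : ℕ} {E : Type*} [MeasurableSpace E]

namespace Policy

variable (π : Policy N τ E) (e : E) (x : ℕ → Fin N → Bool)

@[simp]
lemma length_history (n : ℕ) : (π.history e x n).length = n := by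
  induction n with
  | zero => rfl
  | succ n ih => simp [history, ih]

lemma drop_history (n m : ℕ) : (π.history e x (n + m)).drop m = π.history e x n := by
  induction m with
  | zero => rfl
  | succ m ih => rw [← Nat.add_assoc, history, List.drop_succ_cons, ih]

lemma frameStart_history {t m : ℕ} (hm : m < τ) :
    frameStart τ (π.history e x (t * τ + m)) = π.history e x (t * τ) := by
  rw [frameStart, length_history, Nat.mul_add_mod', Nat.mod_eq_of_lt hm, drop_history]

/-- The clients served successfully in the last `m` slots before slot `n + m`. -/
def delivered (n m : ℕ) : Finset (Fin N) :=
  Finset.univ.filter fun i => (some i, true) ∈ (π.history e x (n + m)).take m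

/-- The outcome of the transmission in slot `n`, or, if the access point idles, the channel state
of a fixed client. -/
def outcome (i₀ : Fin N) (n : ℕ) : Bool := x n ((π.act (π.history e x n) e).getD i₀)

/-- The number of successes in the `m` slots from slot `n` on. -/
def successes (i₀ : Fin N) (n m : ℕ) : ℕ :=
  ∑ l ∈ Finset.range m, (π.outcome e x i₀ (n + l)).toNat

lemma mem_undelivered_history {t m : ℕ} (hm : m < τ) (i : Fin N) :
    i ∈ undelivered τ (π.history e x (t * τ + m)) ↔ i ∉ π.delivered e x (t * τ) m := by
  simp [undelivered, delivered, Nat.mod_eq_of_lt hm]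

lemma delivered_zero (n : ℕ) : π.delivered e x n 0 = ∅ := by simp [delivered]

lemma delivered_succ_of_none {n m : ℕ} (h : π.act (π.history e x (n + m)) e = none) :
    π.delivered e x n (m + 1) = π.delivered e x n m := by
  ext i
  simp [delivered, history, h]

lemma delivered_succ_of_some {n m : ℕ} {i : Fin N} (i₀ : Fin N)
    (h : π.act (π.history e x (n + m)) e = some i) :
    π.delivered e x n (m + 1) =
      if π.outcome e x i₀ (n + m) then insert i (π.delivered e x n m)
      else π.delivered e x n m := by
  have ho : π.outcome e x i₀ (n + m) = x (n + m) i := by simp [outcome, h]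
  rw [ho]
  ext j
  cases hx : x (n + m) i <;> simp [delivered, history, h, hx]

/-- Only undelivered packets are transmitted, so a client receives at most one delivery per frame
and membership in `delivered` is the full count. -/
lemma count_history {t m : ℕ} (hm : m ≤ τ) (j : Fin N) :
    (π.history e x (t * τ + m)).count (some j, true) =
      (π.history e x (t * τ)).count (some j, true) +
        if j ∈ π.delivered e x (t * τ) m then 1 else 0 := by
  induction m with
  | zero => simp [delivered_zero]
  | succ m ih =>
    have ih := ih (by omega)
    rw [← Nat.add_assoc, history, List.count_cons, ih]
    cases h : π.act (π.history e x (t * τ + m)) e with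
    | none => simp [π.delivered_succ_of_none e x h]
    | some i =>
      have hi := (π.mem_undelivered_history e x (by omega) i).1 (π.act_undelivered _ _ _ h)
      rw [π.delivered_succ_of_some e x i h]
      have ho : π.outcome e x i (t * τ + m) = x (t * τ + m) i := by simp [outcome, h]
      rw [ho]
      by_cases hij : j = i
      · subst hij
        cases hx : x (t * τ + m) j <;> simp [hi, hx]
      · have hij' : ¬ i = j := fun h => hij h.symm
        cases hx : x (t * τ + m) i <;> simp [hx, hij, hij']

lemma debt_history_succ (hτ : 0 < τ) (q : ℝ) (t : ℕ) (j : Fin N) :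
    debt τ q (π.history e x ((t + 1) * τ)) j =
      debt τ q (π.history e x (t * τ)) j + q -
        if j ∈ π.delivered e x (t * τ) τ then 1 else 0 := by
  have h := π.count_history e x (t := t) le_rfl j
  have h1 : (t + 1) * τ = t * τ + τ := by ring
  simp only [debt, length_history, Nat.mul_div_cancel _ hτ]
  rw [h1, h]
  push_cast
  ring

lemma successes_succ (i₀ : Fin N) (n m : ℕ) : π.successes e x i₀ n (m + 1) =
    π.successes e x i₀ n m + (π.outcome e x i₀ (n + m)).toNat :=
  Finset.sum_range_succ _ _

lemma successes_succ' (i₀ : Fin N) (n m : ℕ) : π.successes e x i₀ n (m + 1) =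
    (π.outcome e x i₀ n).toNat + π.successes e x i₀ (n + 1) m := by
  rw [successes, Finset.sum_range_succ', add_comm, successes]
  simp [add_assoc, add_comm 1]

variable {π}

/-- As long as a packet is left, a slot is a real transmission and a success delivers a new packet.
After all `N` deliveries the fictitious successes are cut off by the minimum. -/
lemma card_delivered (hπ : π.NonIdling) (i₀ : Fin N) {t m : ℕ} (hm : m ≤ τ) :
    (π.delivered e x (t * τ) m).card = min N (π.successes e x i₀ (t * τ) m) := by
  induction m with
  | zero => simp [delivered_zero, successes]
  | succ m ih =>
    have ih := ih (by omega)
    rw [successes_succ]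
    cases h : π.act (π.history e x (t * τ + m)) e with
    | none =>
      have hun : π.delivered e x (t * τ) m = Finset.univ := by
        by_contra hne
        obtain ⟨i, hi⟩ : ∃ i, i ∉ π.delivered e x (t * τ) m := by
          simpa [Finset.eq_univ_iff_forall] using hne
        exact hπ _ e ⟨i, (π.mem_undelivered_history e x (by omega) i).2 hi⟩ h
      rw [hun, Finset.card_univ, Fintype.card_fin] at ih
      rw [π.delivered_succ_of_none e x h, hun, Finset.card_univ, Fintype.card_fin]
      omega
    | some i =>
      have hi := (π.mem_undelivered_history e x (by omega) i).1 (π.act_undelivered _ _ _ h)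
      have hlt : (π.delivered e x (t * τ) m).card < N := by
        simpa using Finset.card_lt_univ_of_notMem hi
      rw [π.delivered_succ_of_some e x i₀ h]
      cases ho : π.outcome e x i₀ (t * τ + m)
      · simpa using ih
      · simp [hi]
        omega

/-- Under a non-idling policy the total debt depends on the numbers of successes only. -/
lemma sum_debt_history_succ (hπ : π.NonIdling) (hτ : 0 < τ) (i₀ : Fin N) (q : ℝ) (t : ℕ) :
    ∑ j, debt τ q (π.history e x ((t + 1) * τ)) j =
      ∑ j, debt τ q (π.history e x (t * τ)) j +
        (N * q - min (N : ℝ) (π.successes e x i₀ (t * τ) τ)) := by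
  simp only [π.debt_history_succ e x hτ, Finset.sum_sub_distrib, Finset.sum_add_distrib]
  have h := card_delivered e x hπ i₀ (t := t) le_rfl
  have h1 : (∑ j, if j ∈ π.delivered e x (t * τ) τ then (1 : ℝ) else 0) =
      min (N : ℝ) (π.successes e x i₀ (t * τ) τ) := by
    rw [Finset.sum_boole, Finset.filter_mem_eq_inter, Finset.univ_inter, h]
    push_cast
    rfl
  rw [h1]
  simp
  ring

lemma IsMWDF.nonIdling {p q : ℝ} (hπ : π.IsMWDF p q) : π.NonIdling := by
  obtain ⟨order, ho⟩ := hπ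
  intro h e ⟨i, hi⟩ hn
  rw [(ho h e).2, List.find?_eq_none] at hn
  refine hn i ?_ (by simpa using hi)
  rw [List.mem_ofFn]
  exact (order (frameStart τ h) e).surjective i

/-- During a frame, a maximum weighted debt first policy delivers the packets in the order of its
list. -/
lemma mem_delivered_iff {order : History N → E → Equiv.Perm (Fin N)}
    (ho : ∀ h e, π.act h e =
      (List.ofFn (order (frameStart τ h) e)).find? fun i => decide (i ∈ undelivered τ h))
    (i₀ : Fin N) {t m : ℕ} (hm : m ≤ τ) (k : Fin N) :
    order (π.history e x (t * τ)) e k ∈ π.delivered e x (t * τ) m ↔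
      (k : ℕ) < π.successes e x i₀ (t * τ) m := by
  induction m generalizing k with
  | zero => simp [delivered_zero, successes]
  | succ m ih =>
    have ih := fun k => ih (by omega) k
    have hact := ho (π.history e x (t * τ + m)) e
    rw [frameStart_history _ _ _ (by omega)] at hact
    set ρ := order (π.history e x (t * τ)) e
    rw [successes_succ]
    cases h : π.act (π.history e x (t * τ + m)) e with
    | none =>
      rw [π.delivered_succ_of_none e x h, ih]
      rw [h, eq_comm, List.find?_eq_none] at hact
      have hk : (k : ℕ) < π.successes e x i₀ (t * τ) m := by
        have := hact (ρ k) (List.mem_ofFn.2 ⟨k, rfl⟩)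
        rw [decide_eq_true_eq, π.mem_undelivered_history e x (by omega), not_not, ih] at this
        exact this
      omega
    | some i =>
      rw [h, eq_comm, List.find?_eq_some_iff_getElem] at hact
      obtain ⟨hi, r, hr, hri, hbefore⟩ := hact
      rw [decide_eq_true_eq, π.mem_undelivered_history e x (by omega)] at hi
      rw [List.length_ofFn] at hr
      rw [List.getElem_ofFn] at hri
      -- By induction the delivered places are those below the number of successes, so the first
      -- undelivered place is that number.
      have hsr : r = π.successes e x i₀ (t * τ) m := by
        rw [← hri, ih] at hi
        by_contra hne
        have hlt : π.successes e x i₀ (t * τ) m < r := by simp at hi; omega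
        have := hbefore _ hlt
        simp only [List.getElem_ofFn, Bool.not_eq_true', decide_eq_false_iff_not] at this
        rw [π.mem_undelivered_history e x (by omega), not_not, ih] at this
        simp at this
      rw [π.delivered_succ_of_some e x i₀ h]
      cases hx : π.outcome e x i₀ (t * τ + m)
      · simpa using ih k
      · simp only [if_true, Finset.mem_insert, ih, ← hri, ρ.injective.eq_iff, Bool.toNat_true]
        rw [← hsr, Fin.ext_iff]
        simp only
        omega

end Policy

end Pathwise

/-! ### Binomial expectations -/

section Binomial

/-- The expectation of `f` of the number of successes in `m` independent trials, each of success
probability `p`. -/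
def binomialExp (p : ℝ) : ℕ → (ℕ → ℝ) → ℝ
  | 0, f => f 0
  | m + 1, f => (1 - p) * binomialExp p m f + p * binomialExp p m fun s => f (s + 1)

variable {p : ℝ}

lemma binomialExp_add (m : ℕ) (f g : ℕ → ℝ) :
    binomialExp p m (fun s => f s + g s) = binomialExp p m f + binomialExp p m g := by
  induction m generalizing f g with
  | zero => rfl
  | succ m ih =>
    simp only [binomialExp]
    rw [ih f g, ih (fun s => f (s + 1)) (fun s => g (s + 1))]
    ring

lemma binomialExp_const_mul (m : ℕ) (c : ℝ) (f : ℕ → ℝ) :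
    binomialExp p m (fun s => c * f s) = c * binomialExp p m f := by
  induction m generalizing f with
  | zero => rfl
  | succ m ih =>
    simp only [binomialExp]
    rw [ih f, ih (fun s => f (s + 1))]
    ring

lemma binomialExp_const (m : ℕ) (c : ℝ) : binomialExp p m (fun _ => c) = c := by
  induction m with
  | zero => rfl
  | succ m ih =>
    simp only [binomialExp]
    rw [ih]
    ring

lemma binomialExp_mono (hp0 : 0 ≤ p) (hp1 : p ≤ 1) (m : ℕ) {f g : ℕ → ℝ} (h : ∀ s, f s ≤ g s) :
    binomialExp p m f ≤ binomialExp p m g := by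
  induction m generalizing f g with
  | zero => exact h 0
  | succ m ih =>
    exact add_le_add (mul_le_mul_of_nonneg_left (ih h) (by linarith))
      (mul_le_mul_of_nonneg_left (ih fun s => h (s + 1)) hp0)

/-- Condition on the first trial. Up to the factor `p`, this is the recursion of
`busyTime_succ_succ`. -/
lemma binomialExp_min_succ (N m : ℕ) :
    binomialExp p (m + 1) (fun s => min ((N + 1 : ℕ) : ℝ) s) =
      p * (1 + binomialExp p m fun s => min (N : ℝ) s) +
        (1 - p) * binomialExp p m fun s => min ((N + 1 : ℕ) : ℝ) s := by
  have h : (fun s : ℕ => min ((N + 1 : ℕ) : ℝ) ((s + 1 : ℕ) : ℝ)) =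
      fun s : ℕ => 1 + min (N : ℝ) s := by
    ext s
    push_cast
    rw [min_add_add_right, add_comm]
  simp only [binomialExp]
  rw [h, binomialExp_add, binomialExp_const]
  ring

end Binomial

/-! ### Geometric service times and the meaning of the idle fraction -/

section Geometric

variable {p : unitInterval}

/-- Memorylessness: after a failed first trial the count starts afresh. -/
lemma integral_geometricMeasure_succ (hp : p ≠ 0) {f : ℕ → ℝ} {C : ℝ} (hf : ∀ k, |f k| ≤ C) :
    ∫ k, f k ∂geometricMeasure p =
      p * f 0 + (1 - p) * ∫ k, f (k + 1) ∂geometricMeasure p := by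
  have hi : ∀ {g : ℕ → ℝ}, (∀ k, |g k| ≤ C) → Integrable g (geometricMeasure p) := fun hg =>
    .of_bound (measurable_from_nat).aestronglyMeasurable C (.of_forall hg)
  have h1 := hasSum_integral_geometricMeasure hp (hi hf)
  have h2 := hasSum_integral_geometricMeasure hp (hi fun k => hf (k + 1))
  rw [← hasSum_nat_add_iff' 1] at h1
  have h3 := h1.unique ((h2.mul_left (1 - (p : ℝ))).congr_fun fun k => by
    simp only [smul_eq_mul]; ring)
  simp only [Finset.range_one, Finset.sum_singleton, pow_zero, one_mul, smul_eq_mul] at h3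
  linarith

/-- The expectation of `min m (γ₁ + ⋯ + γ_N)` for independent geometric variables. -/
noncomputable def busyTime (p : unitInterval) (N m : ℕ) : ℝ :=
  ∫ g : Fin N → ℕ, min (m : ℝ) (∑ i, ((g i : ℝ) + 1))
    ∂(Measure.pi fun _ : Fin N => geometricMeasure p)

lemma abs_min_natCast_le {m : ℕ} {y : ℝ} (hy : 0 ≤ y) : |min (m : ℝ) y| ≤ m := by
  rw [abs_of_nonneg (le_min (Nat.cast_nonneg m) hy)]
  exact min_le_left _ _

lemma integrable_min_natCast {α : Type*} [MeasurableSpace α] (μ : Measure α) [IsFiniteMeasure μ]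
    (m : ℕ) {y : α → ℝ} (hm : Measurable y) (hy : ∀ g, 0 ≤ y g) :
    Integrable (fun g => min (m : ℝ) (y g)) μ :=
  .of_bound (measurable_const.min hm).aestronglyMeasurable m
    (.of_forall fun g => abs_min_natCast_le (hy g))

lemma measurable_sum_geometric (N : ℕ) (c : ℝ) :
    Measurable fun g : Fin N → ℕ => c + ∑ i, ((g i : ℝ) + 1) :=
  (Finset.measurable_fun_sum _ fun i _ =>
    ((measurable_from_nat (f := fun n : ℕ => (n : ℝ))).comp (measurable_pi_apply i)).add_const
      1).const_add c

lemma sum_geometric_nonneg (N : ℕ) {c : ℝ} (hc : 0 ≤ c) (g : Fin N → ℕ) :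
    0 ≤ c + ∑ i, ((g i : ℝ) + 1) := by positivity

lemma busyTime_succ_eq (N m : ℕ) :
    busyTime p (N + 1) m = ∫ k : ℕ, ∫ g : Fin N → ℕ,
      min (m : ℝ) (((k : ℝ) + 1) + ∑ i, ((g i : ℝ) + 1))
        ∂(Measure.pi fun _ : Fin N => geometricMeasure p) ∂geometricMeasure p := by
  rw [busyTime, ← ((measurePreserving_piFinSuccAbove
    (fun _ : Fin (N + 1) => geometricMeasure p) 0).symm).integral_comp']
  rw [integral_prod]
  · simp [MeasurableEquiv.piFinSuccAbove_symm_apply, Fin.sum_univ_succ, Fin.insertNthEquiv]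
  · have h := integrable_min_natCast ((geometricMeasure p).prod
      (Measure.pi fun _ : Fin N => geometricMeasure p)) m
      (y := fun z => ((z.1 : ℝ) + 1) + ∑ i, ((z.2 i : ℝ) + 1)) ?_ (fun z => by positivity)
    · refine h.congr (.of_forall fun z => ?_)
      simp [MeasurableEquiv.piFinSuccAbove_symm_apply, Fin.sum_univ_succ, Fin.insertNthEquiv]
    · exact (((measurable_from_nat (f := fun n : ℕ => (n : ℝ) + 1)).comp measurable_fst)).add
        (by simpa [Function.comp_def] using (measurable_sum_geometric N 0).comp measurable_snd)

/-- The first attempt takes one slot. With probability `p` it settles the first packet and leaves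
`N` of them; otherwise, by memorylessness, all `N + 1` remain. -/
lemma busyTime_succ_succ (hp : p ≠ 0) (N m : ℕ) :
    busyTime p (N + 1) (m + 1) =
      1 + p * busyTime p N m + (1 - p) * busyTime p (N + 1) m := by
  set H : ℕ → ℝ → ℝ := fun m c => ∫ g : Fin N → ℕ, min (m : ℝ) (c + ∑ i, ((g i : ℝ) + 1))
    ∂(Measure.pi fun _ : Fin N => geometricMeasure p) with hH
  have hHb : ∀ m c, 0 ≤ c → |H m c| ≤ m := fun m c hc => by
    have h := norm_integral_le_of_norm_le_const (C := (m : ℝ))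
      (μ := Measure.pi fun _ : Fin N => geometricMeasure p)
      (f := fun g : Fin N → ℕ => min (m : ℝ) (c + ∑ i, ((g i : ℝ) + 1)))
      (.of_forall fun g => abs_min_natCast_le (sum_geometric_nonneg N hc g))
    simpa using h
  have hHs : ∀ m c, 0 ≤ c → H (m + 1) (c + 1) = 1 + H m c := fun m c hc => by
    have h1 : ∀ g : Fin N → ℕ, min ((m + 1 : ℕ) : ℝ) (c + 1 + ∑ i, ((g i : ℝ) + 1)) =
        1 + min (m : ℝ) (c + ∑ i, ((g i : ℝ) + 1)) := fun g => by
      push_cast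
      rw [add_right_comm, min_add_add_right, add_comm]
    simp only [hH, h1]
    rw [integral_add (integrable_const _) (integrable_min_natCast _ _
      (measurable_sum_geometric N c) (sum_geometric_nonneg N hc))]
    simp
  have h0 : H m 0 = busyTime p N m := by simp [hH, busyTime]
  have hint : Integrable (fun k : ℕ => H m ((k : ℝ) + 1)) (geometricMeasure p) :=
    .of_bound (measurable_from_nat).aestronglyMeasurable m
      (.of_forall fun k => hHb m _ (by positivity))
  rw [busyTime_succ_eq, busyTime_succ_eq,
    integral_geometricMeasure_succ hp (f := fun k => H (m + 1) ((k : ℝ) + 1))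
      fun k => hHb (m + 1) _ (by positivity)]
  have h2 : ∀ k : ℕ, H (m + 1) (((k + 1 : ℕ) : ℝ) + 1) = 1 + H m ((k : ℝ) + 1) := fun k => by
    rw [hHs m _ (by positivity)]; push_cast; rfl
  simp only [h2]
  rw [integral_add (integrable_const _) hint, Nat.cast_zero, hHs m 0 le_rfl, h0]
  simp
  ring

/-- A form of Wald's identity: the expected number of deliveries is `p` times the expected number of
busy slots. Both sides obey the same recursion. -/
lemma binomialExp_min_eq (hp : p ≠ 0) (N m : ℕ) :
    binomialExp p m (fun s => min (N : ℝ) s) = p * busyTime p N m := by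
  induction m generalizing N with
  | zero =>
    have h : ∀ g : Fin N → ℕ, min (0 : ℝ) (∑ i, ((g i : ℝ) + 1)) = 0 := fun g =>
      min_eq_left (by positivity)
    simp [binomialExp, busyTime, h]
  | succ m ih =>
    cases N with
    | zero =>
      have h1 : (fun s : ℕ => min ((0 : ℕ) : ℝ) s) = fun _ => 0 := by
        ext s; simp
      rw [h1, binomialExp_const]
      have h2 : min ((m : ℝ) + 1) 0 = 0 := min_eq_right (by positivity)
      simp [busyTime, h2]
    | succ N =>
      rw [binomialExp_min_succ, ih N, ih (N + 1), busyTime_succ_succ hp]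
      ring

lemma mul_one_sub_idleFraction (N : ℕ) {τ : ℕ} (hτ : 0 < τ) :
    τ * (1 - idleFraction N τ p) = busyTime p N τ := by
  have h1 : ∀ g : Fin N → ℕ, max ((τ : ℝ) - ∑ i, ((g i : ℝ) + 1)) 0 =
      τ - min (τ : ℝ) (∑ i, ((g i : ℝ) + 1)) := fun g => by
    rcases le_total (τ : ℝ) (∑ i, ((g i : ℝ) + 1)) with h | h
    · rw [min_eq_left h, max_eq_right (by linarith), sub_self]
    · rw [min_eq_right h, max_eq_left (by linarith)]
  have h2 := integrable_min_natCast (Measure.pi fun _ : Fin N => geometricMeasure p) τ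
    (measurable_sum_geometric N 0) (sum_geometric_nonneg N le_rfl)
  simp only [zero_add] at h2
  have hτ' : (τ : ℝ) ≠ 0 := by positivity
  simp only [idleFraction, h1]
  rw [integral_sub (integrable_const _) h2, ← busyTime]
  simp
  field_simp
  ring

end Geometric

/-! ### Adaptedness of histories and independence of the channel from the past -/

section Channel

/-- Meant for the seed `m₀`, the past channel `m₁`, the present state `m₂` and the whole channel
`m₃`. The intersections of events of `m₀` and `m₁` form a π-system generating `m₀ ⊔ m₁`, on which
the product formula is checked. -/
lemma indep_sup_of_indep {Ω : Type*} {m : MeasurableSpace Ω} {P : Measure Ω}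
    [IsProbabilityMeasure P] {m₀ m₁ m₂ m₃ : MeasurableSpace Ω} (h₀ : m₀ ≤ m) (h₃ : m₃ ≤ m)
    (h₁₃ : m₁ ≤ m₃) (h₂₃ : m₂ ≤ m₃) (h : Indep m₀ m₃ P) (h' : Indep m₁ m₂ P) :
    Indep m₂ (m₀ ⊔ m₁) P := by
  set S : Set (Set Ω) :=
    Set.image2 (· ∩ ·) {s | MeasurableSet[m₀] s} {s | MeasurableSet[m₁] s} with hS
  have hgen : m₀ ⊔ m₁ = MeasurableSpace.generateFrom S := by
    refine le_antisymm (sup_le (fun s hs => ?_) fun s hs => ?_)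
      (MeasurableSpace.generateFrom_le ?_)
    · exact MeasurableSpace.measurableSet_generateFrom
        ⟨s, hs, Set.univ, MeasurableSet.univ, by simp⟩
    · exact MeasurableSpace.measurableSet_generateFrom
        ⟨Set.univ, MeasurableSet.univ, s, hs, by simp⟩
    · rintro _ ⟨u, hu, a, ha, rfl⟩
      exact MeasurableSet.inter (m := m₀ ⊔ m₁) (le_sup_left (a := m₀) (b := m₁) _ hu)
        (le_sup_right (a := m₀) (b := m₁) _ ha)
  have hpi : IsPiSystem S := by
    rintro _ ⟨u, hu, a, ha, rfl⟩ _ ⟨u', hu', a', ha', rfl⟩ _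
    exact ⟨u ∩ u', MeasurableSet.inter hu hu', a ∩ a', MeasurableSet.inter ha ha',
      Set.inter_inter_inter_comm _ _ _ _⟩
  refine IndepSets.indep (p1 := {s | MeasurableSet[m₂] s}) (p2 := S) (h₂₃.trans h₃)
    (sup_le h₀ (h₁₃.trans h₃)) (@MeasurableSpace.isPiSystem_measurableSet Ω m₂) hpi
    (@MeasurableSpace.generateFrom_measurableSet Ω m₂).symm hgen ?_
  rw [IndepSets_iff]
  rintro b _ hb ⟨u, hu, a, ha, rfl⟩
  have hb : MeasurableSet[m₂] b := hb
  have hu : MeasurableSet[m₀] u := hu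
  have ha : MeasurableSet[m₁] a := ha
  have e1 := (Indep_iff _ _ _).1 h u (a ∩ b) hu ((h₁₃ _ ha).inter (h₂₃ _ hb))
  have e2 := (Indep_iff _ _ _).1 h u a hu (h₁₃ _ ha)
  have e3 := (Indep_iff _ _ _).1 h' a b ha hb
  have e4 : b ∩ (u ∩ a) = u ∩ (a ∩ b) := by
    rw [Set.inter_comm, Set.inter_assoc]
  show P (b ∩ (u ∩ a)) = P b * P (u ∩ a)
  rw [e4, e1, e2, e3]
  ring

variable {Ω E : Type*} [MeasurableSpace E] {N τ : ℕ}

/-- The σ-algebra generated by the seed and the channel states before slot `n`. -/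
abbrev slotSigma (U : Ω → E) (X : ℕ → Ω → Fin N → Bool) (n : ℕ) : MeasurableSpace Ω :=
  MeasurableSpace.comap U inferInstance ⊔ pastSigma X n

lemma slotSigma_mono (U : Ω → E) (X : ℕ → Ω → Fin N → Bool) : Monotone (slotSigma U X) :=
  fun _ _ h => sup_le_sup_left (pastSigma_mono X h) _

lemma measurable_seed_slotSigma (U : Ω → E) (X : ℕ → Ω → Fin N → Bool) (n : ℕ) :
    Measurable[slotSigma U X n] U :=
  Measurable.mono (comap_measurable U) le_sup_left le_rfl

lemma measurable_channel_slotSigma (U : Ω → E) (X : ℕ → Ω → Fin N → Bool) (n : ℕ) (i : Fin N) :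
    Measurable[slotSigma U X (n + 1)] fun ω => X n ω i :=
  Measurable.mono ((measurable_pi_apply i).comp (measurable_pastSigma X n.lt_succ_self))
    le_sup_right le_rfl

namespace Policy

variable (π : Policy N τ E) (U : Ω → E) (X : ℕ → Ω → Fin N → Bool)

/-- There are only countably many histories, so measurability of `act` in the seed for each fixed
history is enough. -/
lemma measurableSet_act_eq {m : MeasurableSpace Ω} {H : Ω → History N}
    (hH : ∀ h, MeasurableSet {ω | H ω = h}) (hU : Measurable U) (a : Option (Fin N)) :
    MeasurableSet {ω | π.act (H ω) (U ω) = a} := by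
  have h1 : {ω | π.act (H ω) (U ω) = a} =
      ⋃ h, {ω | H ω = h} ∩ U ⁻¹' {e | π.act h e = a} := by
    ext ω
    simp
  rw [h1]
  exact MeasurableSet.iUnion fun h => (hH h).inter (hU (π.measurableSet_act h a))

lemma measurableSet_history_eq (n : ℕ) (h : History N) :
    MeasurableSet[slotSigma U X n] {ω | π.history (U ω) (fun n => X n ω) n = h} := by
  induction n generalizing h with
  | zero => exact @MeasurableSet.const Ω (slotSigma U X 0) ([] = h)
  | succ n ih =>
    have hle := slotSigma_mono U X n.le_succ
    cases h with
    | nil =>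
      have h1 : {ω | π.history (U ω) (fun n => X n ω) (n + 1) = []} = ∅ := by
        ext ω; simp [history]
      rw [h1]
      exact @MeasurableSet.empty Ω (slotSigma U X (n + 1))
    | cons r h =>
      have h1 : {ω | π.history (U ω) (fun n => X n ω) (n + 1) = r :: h} =
          ({ω | π.act (π.history (U ω) (fun n => X n ω) n) (U ω) = r.1} ∩
            {ω | r.1.elim false (X n ω) = r.2}) ∩
          {ω | π.history (U ω) (fun n => X n ω) n = h} := by
        ext ω
        simp only [history, List.cons.injEq, Prod.ext_iff, Set.mem_inter_iff, Set.mem_ofPred_eq]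
        constructor
        · rintro ⟨⟨h1, h2⟩, h3⟩
          exact ⟨⟨h1, by rw [← h1]; exact h2⟩, h3⟩
        · rintro ⟨⟨h1, h2⟩, h3⟩
          exact ⟨⟨h1, by rw [h1]; exact h2⟩, h3⟩
      rw [h1]
      refine MeasurableSet.inter (m := slotSigma U X (n + 1)) (MeasurableSet.inter
        (m := slotSigma U X (n + 1)) ?_ ?_) (hle _ (ih h))
      · exact hle _ (measurableSet_act_eq (m := slotSigma U X n) π U ih
          (measurable_seed_slotSigma U X n) r.1)
      · cases r.1 with
        | none => exact @MeasurableSet.const Ω (slotSigma U X (n + 1)) (false = r.2)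
        | some i =>
          exact measurable_channel_slotSigma U X n i (measurableSet_singleton r.2)

/-- The outcome in slot `n`, as a random variable. -/
abbrev outcomeAt (i₀ : Fin N) (n : ℕ) (ω : Ω) : Bool :=
  π.outcome (U ω) (fun n => X n ω) i₀ n

/-- The number of successes in the `m` slots from slot `n` on, as a random variable. -/
abbrev successesAt (i₀ : Fin N) (n m : ℕ) (ω : Ω) : ℕ :=
  π.successes (U ω) (fun n => X n ω) i₀ n m

lemma measurableSet_target_eq (i₀ : Fin N) (n : ℕ) (i : Fin N) :
    MeasurableSet[slotSigma U X n]
      {ω | (π.act (π.history (U ω) (fun n => X n ω) n) (U ω)).getD i₀ = i} := by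
  have h1 : {ω | (π.act (π.history (U ω) (fun n => X n ω) n) (U ω)).getD i₀ = i} =
      ⋃ a ∈ {a : Option (Fin N) | a.getD i₀ = i},
        {ω | π.act (π.history (U ω) (fun n => X n ω) n) (U ω) = a} := by
    ext ω
    simp
  rw [h1]
  exact MeasurableSet.biUnion (m := slotSigma U X n) (Set.to_countable _) fun a _ =>
    measurableSet_act_eq (m := slotSigma U X n) π U (π.measurableSet_history_eq U X n)
      (measurable_seed_slotSigma U X n) a

lemma outcomeAt_preimage (i₀ : Fin N) (n : ℕ) :
    {ω | π.outcomeAt U X i₀ n ω = true} =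
      ⋃ i, {ω | (π.act (π.history (U ω) (fun n => X n ω) n) (U ω)).getD i₀ = i} ∩
        {ω | X n ω i = true} := by
  ext ω
  simp [outcome]

lemma measurableSet_outcomeAt (i₀ : Fin N) (n : ℕ) :
    MeasurableSet[slotSigma U X (n + 1)] {ω | π.outcomeAt U X i₀ n ω = true} := by
  rw [outcomeAt_preimage]
  exact MeasurableSet.iUnion fun i => MeasurableSet.inter
    (slotSigma_mono U X n.le_succ _ (π.measurableSet_target_eq U X i₀ n i))
    (measurable_channel_slotSigma U X n i (measurableSet_singleton true))

lemma measurable_successesAt (i₀ : Fin N) (n m : ℕ) :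
    Measurable[slotSigma U X (n + m)] (π.successesAt U X i₀ n m) := by
  refine Finset.measurable_fun_sum (m := slotSigma U X (n + m)) _ fun l hl => ?_
  have h : MeasurableSet[slotSigma U X (n + m)] {ω | π.outcomeAt U X i₀ (n + l) ω = true} :=
    slotSigma_mono U X (by have := Finset.mem_range.1 hl; omega) _
      (π.measurableSet_outcomeAt U X i₀ (n + l))
  exact (measurable_of_finite Bool.toNat).comp
    (measurable_to_bool (mα := slotSigma U X (n + m)) h)

lemma successes_le {e : E} {x : ℕ → Fin N → Bool} (i₀ : Fin N) (n m : ℕ) :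
    π.successes e x i₀ n m ≤ m := by
  refine (Finset.sum_le_sum fun l _ => Bool.toNat_le _).trans ?_
  simp

end Policy

variable [MeasurableSpace Ω] {P : Measure Ω} [IsProbabilityMeasure P]
  {U : Ω → E} {X : ℕ → Ω → Fin N → Bool}

lemma slotSigma_le (hU : Measurable U) (hX : ∀ n, Measurable (X n)) (n : ℕ) :
    slotSigma U X n ≤ ‹MeasurableSpace Ω› :=
  sup_le hU.comap_le (pastSigma_le hX n)

lemma indep_channel_slotSigma (hU : Measurable U) (hX : ∀ n, Measurable (X n))
    (hXi : iIndepFun X P) (hUX : IndepFun U (fun ω n => X n ω) P) (n : ℕ) :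
    Indep (MeasurableSpace.comap (X n) inferInstance) (slotSigma U X n) P := by
  have hall : Measurable fun ω n => X n ω := measurable_pi_lambda _ hX
  have hle : ∀ k, MeasurableSpace.comap (X k) inferInstance ≤
      MeasurableSpace.comap (fun ω n => X n ω) inferInstance := fun k =>
    ((measurable_pi_apply k).comp (comap_measurable fun ω n => X n ω)).comap_le
  have h := indep_iSup_of_disjoint (S := {i | i < n}) (T := {n})
    (fun k => (hX k).comap_le) hXi (by simp)
  rw [iSup_singleton] at h
  exact indep_sup_of_indep hU.comap_le hall.comap_le (iSup₂_le fun k _ => hle k) (hle n) hUX h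

namespace Policy

variable (π : Policy N τ E) {p : unitInterval}

/-- The target of the slot is determined by the past, and every possible target has a channel state
that is independent of the past and good with the same probability `p`. -/
lemma measure_inter_outcomeAt (hU : Measurable U) (hX : ∀ n, Measurable (X n))
    (hXi : iIndepFun X P) (hXp : ∀ n i, P {ω | X n ω i = true} = ENNReal.ofReal p)
    (hUX : IndepFun U (fun ω n => X n ω) P) (i₀ : Fin N) (n : ℕ) {A : Set Ω}
    (hA : MeasurableSet[slotSigma U X n] A) :
    P (A ∩ {ω | π.outcomeAt U X i₀ n ω = true}) = ENNReal.ofReal p * P A := by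
  set D : Fin N → Set Ω := fun i =>
    {ω | (π.act (π.history (U ω) (fun n => X n ω) n) (U ω)).getD i₀ = i} with hD
  have hDm : ∀ i, MeasurableSet[slotSigma U X n] (D i) := π.measurableSet_target_eq U X i₀ n
  have hle := slotSigma_le hU hX
  have hAD : ∀ i, MeasurableSet[slotSigma U X n] (A ∩ D i) :=
    fun i => MeasurableSet.inter hA (hDm i)
  have hdisj : Pairwise (Function.onFun Disjoint D) := fun i j hij =>
    Set.disjoint_left.2 fun ω h1 h2 =>
      hij (by simp only [hD, Set.mem_ofPred_eq] at h1 h2; rw [← h1, ← h2])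
  have hXm : ∀ i, MeasurableSet {ω | X n ω i = true} := fun i =>
    ((measurable_pi_apply i).comp (hX n)) (measurableSet_singleton true)
  have h1 : A ∩ {ω | π.outcomeAt U X i₀ n ω = true} =
      ⋃ i, (A ∩ D i) ∩ {ω | X n ω i = true} := by
    rw [outcomeAt_preimage, Set.inter_iUnion]
    simp only [hD, Set.inter_assoc]
  have h2 : A = ⋃ i, A ∩ D i := by
    ext ω; simp [hD]
  have h3 : ∀ i, P ((A ∩ D i) ∩ {ω | X n ω i = true}) = P (A ∩ D i) * ENNReal.ofReal p :=
    fun i => by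
      rw [← hXp n i]
      exact (Indep_iff _ _ _).1 (indep_channel_slotSigma hU hX hXi hUX n).symm _ _ (hAD i)
        ⟨(fun z => z i) ⁻¹' {true}, measurable_pi_apply i (measurableSet_singleton true), rfl⟩
  rw [h1, measure_iUnion (fun i j hij => (hdisj hij).mono (fun ω h => h.1.2) fun ω h => h.1.2)
    fun i => (hle n _ (hAD i)).inter (hXm i)]
  conv_rhs => rw [h2, measure_iUnion
    (fun i j hij => (hdisj hij).mono (fun ω h => h.2) fun ω h => h.2) fun i => hle n _ (hAD i)]
  rw [← ENNReal.tsum_mul_left]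
  exact tsum_congr fun i => by rw [h3, mul_comm]

/-- The numbers of successes are binomial and independent of the past. -/
lemma setIntegral_successesAt (hU : Measurable U) (hX : ∀ n, Measurable (X n))
    (hXi : iIndepFun X P) (hXp : ∀ n i, P {ω | X n ω i = true} = ENNReal.ofReal p)
    (hUX : IndepFun U (fun ω n => X n ω) P) (i₀ : Fin N) (n m : ℕ) {A : Set Ω}
    (hA : MeasurableSet[slotSigma U X n] A) (f : ℕ → ℝ) :
    ∫ ω in A, f (π.successesAt U X i₀ n m ω) ∂P = P.real A * binomialExp p m f := by
  -- The first slot is split off, so the starting slot, the past event and the function all change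
  -- in the induction.
  induction m generalizing n A f with
  | zero => simp [binomialExp, successes]
  | succ m ih =>
    have hle := slotSigma_le hU hX
    set O := {ω | π.outcomeAt U X i₀ n ω = true} with hO
    have hOm := π.measurableSet_outcomeAt U X i₀ n
    have hA' := slotSigma_mono U X n.le_succ _ hA
    have hint : Integrable (fun ω => f (π.successesAt U X i₀ n (m + 1) ω)) P := by
      refine .of_bound (measurable_from_nat.comp ((π.measurable_successesAt U X i₀ n
        (m + 1)).mono (hle _) le_rfl)).aestronglyMeasurable
        (∑ s ∈ Finset.range (m + 2), |f s|) (.of_forall fun ω => ?_)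
      exact Finset.single_le_sum (f := fun s => |f s|) (fun _ _ => abs_nonneg _)
        (Finset.mem_range.2 (Nat.lt_succ_of_le (π.successes_le i₀ n (m + 1))))
    rw [← integral_inter_add_sdiff (hle _ _ hOm) hint.integrableOn]
    have h1 : ∫ ω in A ∩ O, f (π.successesAt U X i₀ n (m + 1) ω) ∂P =
        ∫ ω in A ∩ O, f (π.successesAt U X i₀ (n + 1) m ω + 1) ∂P := by
      refine setIntegral_congr_fun ((hle _ _ hA).inter (hle _ _ hOm)) fun ω hω => ?_
      have : π.outcomeAt U X i₀ n ω = true := hω.2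
      simp only [successesAt, successes_succ', this, Bool.toNat_true, add_comm]
    have h2 : ∫ ω in A \ O, f (π.successesAt U X i₀ n (m + 1) ω) ∂P =
        ∫ ω in A \ O, f (π.successesAt U X i₀ (n + 1) m ω) ∂P := by
      refine setIntegral_congr_fun ((hle _ _ hA).diff (hle _ _ hOm)) fun ω hω => ?_
      have : π.outcomeAt U X i₀ n ω = false := by
        simpa [hO] using hω.2
      simp only [successesAt, successes_succ', this, Bool.toNat_false, zero_add]
    have h3 := π.measure_inter_outcomeAt hU hX hXi hXp hUX i₀ n hA
    have h4 : P.real (A ∩ O) = p * P.real A := by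
      rw [measureReal_def, h3, ENNReal.toReal_mul, ENNReal.toReal_ofReal p.2.1, measureReal_def]
    have h5 : P.real (A \ O) = (1 - p) * P.real A := by
      have := measureReal_inter_add_sdiff (μ := P) (s := A) (hle _ _ hOm)
      linarith
    rw [h1, h2, ih (n + 1) (MeasurableSet.inter hA' hOm) fun s => f (s + 1),
      ih (n + 1) (MeasurableSet.diff hA' hOm) f, h4, h5, binomialExp]
    ring

end Policy

end Channel

/-! ### The deviation from the mean as a Lyapunov function -/

section Deviation

variable {N : ℕ}

/-- The sum of the squared deviations from the mean. -/
noncomputable def sqDev (d : Fin N → ℝ) : ℝ := ∑ j, (d j - (∑ i, d i) / N) ^ 2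

lemma sqDev_nonneg (d : Fin N → ℝ) : 0 ≤ sqDev d := Finset.sum_nonneg fun _ _ => sq_nonneg _

lemma sqDev_comp_perm (d : Fin N → ℝ) (ρ : Equiv.Perm (Fin N)) : sqDev (d ∘ ρ) = sqDev d := by
  have h1 : ∑ i, d (ρ i) = ∑ i, d i := Equiv.sum_comp ρ d
  simp only [sqDev, Function.comp_apply, h1]
  exact Equiv.sum_comp ρ fun j => (d j - (∑ i, d i) / N) ^ 2

lemma sqDev_add_const (hN : 0 < N) (d : Fin N → ℝ) (c : ℝ) :
    sqDev (fun j => d j + c) = sqDev d := by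
  have hN' : (N : ℝ) ≠ 0 := by positivity
  simp only [sqDev, Finset.sum_add_distrib, Finset.sum_const, Finset.card_univ, Fintype.card_fin,
    nsmul_eq_mul]
  refine Finset.sum_congr rfl fun j _ => ?_
  congr 1
  field_simp
  ring

lemma sq_sub_mean_le_sqDev (d : Fin N → ℝ) (j : Fin N) : (d j - (∑ i, d i) / N) ^ 2 ≤ sqDev d :=
  Finset.single_le_sum (f := fun j => (d j - (∑ i, d i) / N) ^ 2) (fun _ _ => sq_nonneg _)
    (Finset.mem_univ j)

/-- The debts after a frame with `s` successes, for the debts `z` in the order of service. -/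
def stepDebt (q : ℝ) (z : Fin N → ℝ) (s : ℕ) (k : Fin N) : ℝ :=
  z k + q - if (k : ℕ) < s then 1 else 0

/-- The sum of the first `s` members of a family. -/
def headSum (a : Fin N → ℝ) (s : ℕ) : ℝ := ∑ k : Fin N, if (k : ℕ) < s then a k else 0

/-- The common shift `q` does not affect deviations. Expanding the square, the cross term is
`headSum` and the remainder `R` is the deviation of the indicator of the served places. -/
lemma exists_sqDev_stepDebt (hN : 0 < N) (q : ℝ) (z : Fin N → ℝ) (s : ℕ) :
    ∃ R : ℝ, 0 ≤ R ∧ R ≤ N ∧ sqDev (stepDebt q z s) =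
      sqDev z - 2 * headSum (fun k => z k - (∑ i, z i) / N) s + R := by
  have hN' : (N : ℝ) ≠ 0 := by positivity
  set a : Fin N → ℝ := fun k => z k - (∑ i, z i) / N with ha
  set c : Fin N → ℝ := fun k => if (k : ℕ) < s then 1 else 0 with hc
  have hsa : ∑ k, a k = 0 := by
    simp only [ha, Finset.sum_sub_distrib, Finset.sum_const, Finset.card_univ, Fintype.card_fin,
      nsmul_eq_mul]
    field_simp
    ring
  have hac : ∑ k, a k * c k = headSum a s := by simp [headSum, hc]
  have hcc : ∑ k, c k ^ 2 ≤ N := by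
    refine (Finset.sum_le_sum (g := fun _ => (1 : ℝ)) fun k _ => ?_).trans (by simp)
    simp only [hc]; split_ifs <;> norm_num
  refine ⟨∑ k, (c k - (∑ i, c i) / N) ^ 2, Finset.sum_nonneg fun _ _ => sq_nonneg _, ?_, ?_⟩
  · have h1 : ∑ k, (c k - (∑ i, c i) / N) ^ 2 = ∑ k, c k ^ 2 - (∑ i, c i) ^ 2 / N := by
      simp only [sub_sq, Finset.sum_add_distrib, Finset.sum_sub_distrib, Finset.sum_const,
        Finset.card_univ, Fintype.card_fin, nsmul_eq_mul, mul_assoc, ← Finset.mul_sum,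
        ← Finset.sum_mul]
      field_simp
      ring
    have : 0 ≤ (∑ i, c i) ^ 2 / (N : ℝ) := by positivity
    linarith
  · have h2 : ∀ k, stepDebt q z s k - (∑ i, stepDebt q z s i) / N =
        a k - (c k - (∑ i, c i) / N) := fun k => by
      have : ∑ i, stepDebt q z s i = ∑ i, z i + N * q - ∑ i, c i := by
        simp [stepDebt, hc, Finset.sum_sub_distrib, Finset.sum_add_distrib]
      rw [this]
      simp only [stepDebt, ha, hc]
      field_simp
      ring
    have h3 : ∀ k, (a k - (c k - (∑ i, c i) / N)) ^ 2 =
        a k ^ 2 - 2 * (a k * c k) + 2 * ((∑ i, c i) / N) * a k + (c k - (∑ i, c i) / N) ^ 2 :=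
      fun k => by ring
    have h4 : sqDev z = ∑ k, a k ^ 2 := rfl
    rw [sqDev]
    simp only [h2, h3, Finset.sum_add_distrib, Finset.sum_sub_distrib, ← Finset.mul_sum, hsa, hac,
      h4]
    ring

/-- If the entry at place `s` is nonnegative, the head has nonnegative terms, the first at least
`μ`. Otherwise the tail has nonpositive terms, the last at most `-μ`, and the head is minus the
tail. -/
lemma le_headSum_of_antitone {a : Fin N → ℝ} (ha : Antitone a) (h0 : ∑ k, a k = 0) (s : ℕ)
    {μ : ℝ} (hμ1 : ∀ k : Fin N, (k : ℕ) = 0 → μ ≤ a k)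
    (hμ2 : ∀ k : Fin N, (k : ℕ) + 1 = N → a k ≤ -μ)
    (hs : 0 < s) (hsN : s < N) : μ ≤ headSum a s := by
  have hsplit : headSum a s = -∑ k : Fin N, if (k : ℕ) < s then 0 else a k := by
    rw [eq_neg_iff_add_eq_zero, headSum, ← Finset.sum_add_distrib]
    refine (Finset.sum_congr rfl fun k _ => ?_).trans h0
    split_ifs <;> simp
  rcases le_total 0 (a ⟨s, hsN⟩) with h | h
  · refine (hμ1 ⟨0, by omega⟩ rfl).trans ?_
    have := Finset.single_le_sum (f := fun k : Fin N => if (k : ℕ) < s then a k else 0)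
      (fun k _ => ?_) (Finset.mem_univ (⟨0, by omega⟩ : Fin N))
    · simpa [hs, headSum] using this
    · show 0 ≤ if (k : ℕ) < s then a k else 0
      split_ifs with hk
      · exact h.trans (ha (Fin.mk_le_mk.2 hk.le : k ≤ ⟨s, hsN⟩))
      · exact le_rfl
  · rw [hsplit, le_neg]
    refine le_trans ?_ (hμ2 ⟨N - 1, by omega⟩ (by simp; omega))
    rw [← neg_le_neg_iff, ← Finset.sum_neg_distrib]
    have := Finset.single_le_sum (f := fun k : Fin N => -if (k : ℕ) < s then 0 else a k)
      (fun k _ => ?_) (Finset.mem_univ (⟨N - 1, by omega⟩ : Fin N))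
    · simpa [show ¬ N - 1 < s by omega] using this
    · show 0 ≤ -if (k : ℕ) < s then 0 else a k
      split_ifs with hk
      · simp
      · have := ha (Fin.mk_le_mk.2 (not_lt.1 hk) : (⟨s, hsN⟩ : Fin N) ≤ k)
        linarith

lemma headSum_eq_zero {a : Fin N → ℝ} (h0 : ∑ k, a k = 0) {s : ℕ} (hs : s = 0 ∨ N ≤ s) :
    headSum a s = 0 := by
  rcases hs with rfl | hs
  · simp [headSum]
  · rw [← h0, headSum]
    exact Finset.sum_congr rfl fun k _ => if_pos (by omega)

/-- Serving in the order of decreasing debts reduces the deviation. -/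
lemma div_le_headSum {a : Fin N → ℝ} (ha : Antitone a) (h0 : ∑ k, a k = 0) {s : ℕ}
    (hs : 0 < s) (hsN : s < N) :
    Real.sqrt (∑ k, a k ^ 2) / (N : ℝ) ^ 2 ≤ headSum a s := by
  have hN : 1 < N := by omega
  have hN1 : (1 : ℝ) ≤ N := by exact_mod_cast hN.le
  set f : Fin N := ⟨0, by omega⟩ with hf
  set l : Fin N := ⟨N - 1, by omega⟩ with hl
  have hfk : ∀ k, a k ≤ a f := fun k => ha (Fin.mk_le_mk.2 (Nat.zero_le _) : f ≤ k)
  have hlk : ∀ k, a l ≤ a k := fun k => ha (Fin.le_def.2 (by simp [hl]; omega) : k ≤ l)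
  have hf0 : 0 ≤ a f := by
    by_contra h
    push Not at h
    have := Finset.sum_lt_sum_of_nonempty (s := Finset.univ) ⟨f, Finset.mem_univ f⟩
      fun k _ => lt_of_le_of_lt (hfk k) h
    simp [h0] at this
  have hl0 : a l ≤ 0 := by
    by_contra h
    push Not at h
    have := Finset.sum_lt_sum_of_nonempty (s := Finset.univ) ⟨f, Finset.mem_univ f⟩
      fun k _ => lt_of_lt_of_le h (hlk k)
    simp [h0] at this
  set μ := min (a f) (-a l) with hμ
  have hμ0 : 0 ≤ μ := le_min hf0 (by linarith)
  have hsum : ∀ m : Fin N, a m + ∑ k ∈ Finset.univ.erase m, a k = 0 := fun m => by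
    rw [Finset.add_sum_erase _ _ (Finset.mem_univ m), h0]
  have hcard : ∀ m : Fin N, (((Finset.univ : Finset (Fin N)).erase m).card : ℝ) = N - 1 :=
    fun m => by
      rw [Finset.card_erase_of_mem (Finset.mem_univ m), Finset.card_univ, Fintype.card_fin,
        Nat.cast_sub hN.le]
      simp
  -- As the sum is `0`, the largest entry and minus the smallest are within a factor `N - 1` of each
  -- other, so every entry is at most `N μ` in absolute value.
  have hfl : a f ≤ (N - 1) * -a l := by
    have h1 := hsum f
    have h2 := Finset.card_nsmul_le_sum (Finset.univ.erase f) a (a l) fun k _ => hlk k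
    rw [nsmul_eq_mul, hcard] at h2
    linarith
  have hlf : -a l ≤ (N - 1) * a f := by
    have h1 := hsum l
    have h2 := Finset.sum_le_card_nsmul (Finset.univ.erase l) a (a f) fun k _ => hfk k
    rw [nsmul_eq_mul, hcard] at h2
    linarith
  have hfμ : a f ≤ N * μ := by
    rcases min_choice (a f) (-a l) with h | h <;> rw [hμ, h] <;> nlinarith
  have hlμ : -a l ≤ N * μ := by
    rcases min_choice (a f) (-a l) with h | h <;> rw [hμ, h] <;> nlinarith
  have hV : Real.sqrt (∑ k, a k ^ 2) ≤ N ^ 2 * μ := by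
    rw [Real.sqrt_le_left (by positivity)]
    calc ∑ k, a k ^ 2 ≤ ∑ _k : Fin N, (N * μ) ^ 2 := Finset.sum_le_sum fun k _ =>
          sq_le_sq' (by linarith [hlk k]) (by linarith [hfk k])
      _ = N * (N * μ) ^ 2 := by simp
      _ ≤ N ^ 2 * (N * μ) ^ 2 := by gcongr; nlinarith
      _ = (N ^ 2 * μ) ^ 2 := by ring
  refine ((div_le_iff₀ (by positivity)).2 (by linarith)).trans
    (le_headSum_of_antitone ha h0 s (μ := μ) ?_ ?_ hs hsN)
  · intro k hk
    have : k = f := Fin.ext hk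
    rw [this]
    exact min_le_left _ _
  · intro k hk
    have : k = l := Fin.ext (by simp [hl]; omega)
    rw [this]
    linarith [min_le_right (a f) (-a l)]

/-- With `Q = √V` the left side bounds the drift of `V³`. Its leading term is `-6 c Q⁵`; the others
have degree at most `4`. -/
lemma exists_forall_drift_le {c n : ℝ} (hc : 0 < c) (hn : 0 ≤ n) :
    ∃ K, 0 ≤ K ∧ ∀ Q, 0 ≤ Q → 3 * Q ^ 4 * (-2 * c * Q + n) + 3 * Q ^ 2 * (2 * n * Q + n) ^ 2 +
      (2 * n * Q + n) ^ 3 ≤ K := by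
  set D := 3 * n + 27 * n ^ 2 + 27 * n ^ 3 with hD
  have hD0 : 0 ≤ D := by positivity
  -- `D` bounds the case `Q ≤ 1`. For `Q ≥ 1` the expression is at most `Q⁴ (D - 6 c Q)`, which is
  -- positive only if `Q < D / (6 c)`.
  refine ⟨D + D * (D / (6 * c)) ^ 4, by positivity, fun Q hQ => ?_⟩
  rcases le_total Q 1 with h | h
  · have h1 : 2 * n * Q + n ≤ 3 * n := by nlinarith
    have h2 : 0 ≤ 2 * n * Q + n := by positivity
    calc _ ≤ 3 * Q ^ 4 * n + 3 * Q ^ 2 * (2 * n * Q + n) ^ 2 + (2 * n * Q + n) ^ 3 := by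
          have : 0 ≤ 3 * Q ^ 4 * (2 * c * Q) := by positivity
          nlinarith
      _ ≤ 3 * 1 ^ 4 * n + 3 * 1 ^ 2 * (3 * n) ^ 2 + (3 * n) ^ 3 := by gcongr
      _ = D := by rw [hD]; ring
      _ ≤ _ := le_add_of_nonneg_right (by positivity)
  · have h1 : 2 * n * Q + n ≤ 3 * n * Q := by nlinarith
    have h2 : 0 ≤ 2 * n * Q + n := by positivity
    have h3 : 3 * Q ^ 4 * (-2 * c * Q + n) + 3 * Q ^ 2 * (2 * n * Q + n) ^ 2 +
        (2 * n * Q + n) ^ 3 ≤ Q ^ 4 * (D - 6 * c * Q) := by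
      calc _ ≤ 3 * Q ^ 4 * (-2 * c * Q + n) + 3 * Q ^ 2 * (3 * n * Q) ^ 2 + (3 * n * Q) ^ 3 := by
            gcongr
        _ = 3 * Q ^ 4 * (-2 * c * Q + n) + 27 * n ^ 2 * Q ^ 4 + 27 * n ^ 3 * Q ^ 3 := by ring
        _ ≤ 3 * Q ^ 4 * (-2 * c * Q + n) + 27 * n ^ 2 * Q ^ 4 + 27 * n ^ 3 * Q ^ 4 := by
            gcongr 3 * Q ^ 4 * (-2 * c * Q + n) + 27 * n ^ 2 * Q ^ 4 + 27 * n ^ 3 * ?_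
            exact pow_le_pow_right₀ h (by norm_num)
        _ = _ := by rw [hD]; ring
    refine h3.trans ?_
    rcases le_total D (6 * c * Q) with h4 | h4
    · exact (mul_nonpos_of_nonneg_of_nonpos (by positivity) (by linarith)).trans (by positivity)
    · have hcQ : 0 ≤ 6 * c * Q := by positivity
      by_cases h5 : Q ≤ D / (6 * c)
      · calc Q ^ 4 * (D - 6 * c * Q) ≤ (D / (6 * c)) ^ 4 * D := by gcongr; linarith
          _ ≤ _ := by linarith
      · push Not at h5
        rw [div_lt_iff₀ (by positivity)] at h5
        linarith

/-- The drift of the third power of the deviation is bounded above. -/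
lemma exists_binomialExp_sqDev_le (hN : 0 < N) {p : ℝ} (hp0 : 0 ≤ p) (hp1 : p ≤ 1) {m : ℕ}
    (hθ : 0 < binomialExp p m fun s => if 0 < s ∧ s < N then 1 else 0) (q : ℝ) :
    ∃ K, 0 ≤ K ∧ ∀ z : Fin N → ℝ, Antitone z →
      binomialExp p m (fun s => sqDev (stepDebt q z s) ^ 3) ≤ sqDev z ^ 3 + K := by
  set θ := binomialExp p m fun s => if 0 < s ∧ s < N then 1 else 0 with hθ_def
  have hN0 : (0 : ℝ) < N := by exact_mod_cast hN
  obtain ⟨K, hK0, hK⟩ := exists_forall_drift_le (c := θ / (N : ℝ) ^ 2) (n := N)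
    (by positivity) hN0.le
  refine ⟨K, hK0, fun z hz => ?_⟩
  set a : Fin N → ℝ := fun k => z k - (∑ i, z i) / N with ha
  have haa : Antitone a := fun i j hij => sub_le_sub_right (hz hij) _
  have hsa : ∑ k, a k = 0 := by
    simp only [ha, Finset.sum_sub_distrib, Finset.sum_const, Finset.card_univ, Fintype.card_fin,
      nsmul_eq_mul]
    field_simp
    ring
  set V := sqDev z with hV
  have hV0 : 0 ≤ V := sqDev_nonneg z
  set Q := Real.sqrt V with hQ
  have hQ0 : 0 ≤ Q := Real.sqrt_nonneg _
  have hQV : Q ^ 2 = V := Real.sq_sqrt hV0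
  have haQ : ∀ k, |a k| ≤ Q := fun k => Real.abs_le_sqrt (sq_sub_mean_le_sqDev z k)
  have hG : ∀ s, |headSum a s| ≤ N * Q := fun s => by
    refine (Finset.abs_sum_le_sum_abs _ _).trans
      ((Finset.sum_le_sum (g := fun _ => Q) fun k _ => ?_).trans (by simp))
    show |if (k : ℕ) < s then a k else 0| ≤ Q
    split_ifs
    · exact haQ k
    · simpa using hQ0
  set L := 2 * N * Q + N with hL
  have hpt : ∀ s, sqDev (stepDebt q z s) ^ 3 ≤
      (V ^ 3 + 3 * V ^ 2 * N + 3 * V * L ^ 2 + L ^ 3) +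
        (-(6 * V ^ 2 * (Q / (N : ℝ) ^ 2))) * (if 0 < s ∧ s < N then 1 else 0) := fun s => by
    obtain ⟨R, hR0, hRN, hR⟩ := exists_sqDev_stepDebt hN q z s
    rw [hR]
    set G := headSum a s with hGdef
    have hδ : |(-2 * G + R)| ≤ L := by
      have h1 := abs_le.1 (hG s)
      rw [abs_le, hL]
      constructor <;> nlinarith
    set δ := -2 * G + R with hδ_def
    have hδ2 : δ ^ 2 ≤ L ^ 2 := sq_le_sq' (abs_le.1 hδ).1 (abs_le.1 hδ).2
    have hδ3 : δ ^ 3 ≤ L ^ 3 := by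
      calc δ ^ 3 ≤ |δ ^ 3| := le_abs_self _
        _ = |δ| ^ 3 := abs_pow _ _
        _ ≤ L ^ 3 := by gcongr
    -- The restoring force, proportional to `Q`, is present exactly in the frames that separate the
    -- clients.
    have hδ1 : δ ≤ N - 2 * (Q / (N : ℝ) ^ 2) * (if 0 < s ∧ s < N then 1 else 0) := by
      split_ifs with hs
      · have := div_le_headSum haa hsa hs.1 hs.2
        have h2 : Real.sqrt (∑ k, a k ^ 2) = Q := rfl
        rw [h2] at this
        linarith
      · have : G = 0 := headSum_eq_zero hsa (by omega)
        linarith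
    calc (V - 2 * G + R) ^ 3 = V ^ 3 + 3 * V ^ 2 * δ + 3 * V * δ ^ 2 + δ ^ 3 := by
          rw [hδ_def]; ring
      _ ≤ V ^ 3 + 3 * V ^ 2 * (N - 2 * (Q / (N : ℝ) ^ 2) * (if 0 < s ∧ s < N then 1 else 0)) +
          3 * V * L ^ 2 + L ^ 3 := by gcongr
      _ = _ := by ring
  refine (binomialExp_mono hp0 hp1 m hpt).trans ?_
  rw [binomialExp_add, binomialExp_const, binomialExp_const_mul, ← hθ_def]
  have := hK Q hQ0
  rw [← hQV, hL]
  have h3 : 3 * Q ^ 4 * (-2 * (θ / (N : ℝ) ^ 2) * Q + N) =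
      3 * (Q ^ 2) ^ 2 * N - 6 * (Q ^ 2) ^ 2 * (Q / (N : ℝ) ^ 2) * θ := by
    field_simp
    ring
  linarith

/-- If nobody or everybody is served, all debts move by the same amount. -/
lemma stepDebt_of_not (q : ℝ) (z : Fin N → ℝ) {s : ℕ} (hs : ¬(0 < s ∧ s < N)) (hN : 0 < N) :
    sqDev (stepDebt q z s) = sqDev z := by
  rcases Nat.eq_zero_or_pos s with rfl | h
  · rw [← sqDev_add_const hN z q]
    congr 1
    ext k
    simp [stepDebt]
  · rw [← sqDev_add_const hN z (q - 1)]
    congr 1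
    ext k
    have : (k : ℕ) < s := by omega
    simp [stepDebt, this]
    ring

/-- A permutation that lists the members of a family in decreasing order. -/
noncomputable def sortDecreasing (d : Fin N → ℝ) : Equiv.Perm (Fin N) := Tuple.sort fun i => -d i

lemma antitone_sortDecreasing (d : Fin N → ℝ) : Antitone (d ∘ sortDecreasing d) := fun _ _ hij =>
  neg_le_neg_iff.1 (Tuple.monotone_sort (fun i => -d i) hij)

/-- Orders that break ties differently list the same values. So the order of the policy, for which
no measurability is assumed, may be replaced by `sortDecreasing`. -/
lemma comp_eq_of_antitone {d : Fin N → ℝ} {ρ ρ' : Equiv.Perm (Fin N)} (h : Antitone (d ∘ ρ))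
    (h' : Antitone (d ∘ ρ')) : d ∘ ρ = d ∘ ρ' := by
  have := Tuple.unique_monotone (f := fun i => -d i) (σ := ρ) (τ := ρ')
    (fun i j hij => neg_le_neg (h hij)) (fun i j hij => neg_le_neg (h' hij))
  ext k
  exact neg_injective (congrFun this k)

end Deviation

/-! ### The total debt as a random walk -/

section Frames

variable {Ω E : Type*} [MeasurableSpace E] {N τ : ℕ} [MeasurableSpace Ω]

/-- Independent channel states with success probability `p`, and an independent seed. -/
structure IsChannel (P : Measure Ω) (U : Ω → E) (X : ℕ → Ω → Fin N → Bool) (p : unitInterval) :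
    Prop where
  measurable_seed : Measurable U
  measurable_channel : ∀ n, Measurable (X n)
  iIndepFun_channel : iIndepFun X P
  measure_success : ∀ n i, P {ω | X n ω i = true} = ENNReal.ofReal p
  indepFun_seed : IndepFun U (fun ω n => X n ω) P

variable {P : Measure Ω} {U : Ω → E} {X : ℕ → Ω → Fin N → Bool}
  {p : unitInterval}

namespace Policy

variable (π : Policy N τ E) (U X) in
/-- The number of successes in frame `t`. -/
abbrev frameSuccesses (i₀ : Fin N) (t : ℕ) (ω : Ω) : ℕ :=
  π.successesAt U X i₀ (t * τ) τ ω

variable (π : Policy N τ E)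

lemma measurable_frameSuccesses (hC : IsChannel P U X p) (i₀ : Fin N) (t : ℕ) :
    Measurable (π.frameSuccesses U X i₀ t) :=
  (π.measurable_successesAt U X i₀ (t * τ) τ).mono
    (slotSigma_le hC.measurable_seed hC.measurable_channel _) le_rfl

variable [IsProbabilityMeasure P]

lemma setIntegral_frameSuccesses (hC : IsChannel P U X p) (i₀ : Fin N) (t : ℕ) {A : Set Ω}
    (hA : MeasurableSet[slotSigma U X (t * τ)] A) (f : ℕ → ℝ) :
    ∫ ω in A, f (π.frameSuccesses U X i₀ t ω) ∂P = P.real A * binomialExp p τ f :=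
  π.setIntegral_successesAt hC.measurable_seed hC.measurable_channel hC.iIndepFun_channel
    hC.measure_success hC.indepFun_seed i₀ (t * τ) τ hA f

lemma integral_frameSuccesses (hC : IsChannel P U X p) (i₀ : Fin N) (t : ℕ) (f : ℕ → ℝ) :
    ∫ ω, f (π.frameSuccesses U X i₀ t ω) ∂P = binomialExp p τ f := by
  have h := π.setIntegral_frameSuccesses hC i₀ t (@MeasurableSet.univ Ω (slotSigma U X (t * τ))) f
  simpa using h

lemma measureReal_inter_frameSuccesses (hC : IsChannel P U X p) (i₀ : Fin N) (t : ℕ) {A : Set Ω}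
    (hA : MeasurableSet[slotSigma U X (t * τ)] A) (B : Set ℕ) :
    P.real (A ∩ π.frameSuccesses U X i₀ t ⁻¹' B) =
      P.real A * binomialExp p τ (B.indicator 1) := by
  have hBm : MeasurableSet (π.frameSuccesses U X i₀ t ⁻¹' B) :=
    π.measurable_frameSuccesses hC i₀ t (MeasurableSet.of_discrete (s := B))
  rw [← π.setIntegral_frameSuccesses hC i₀ t hA]
  have h1 : ∀ ω, B.indicator (1 : ℕ → ℝ) (π.frameSuccesses U X i₀ t ω) =
      (π.frameSuccesses U X i₀ t ⁻¹' B).indicator 1 ω := fun ω => rfl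
  simp only [h1]
  rw [integral_indicator_one hBm, measureReal_restrict_apply hBm, Set.inter_comm]

lemma measureReal_frameSuccesses (hC : IsChannel P U X p) (i₀ : Fin N) (t : ℕ) (B : Set ℕ) :
    P.real (π.frameSuccesses U X i₀ t ⁻¹' B) = binomialExp p τ (B.indicator 1) := by
  have h := π.measureReal_inter_frameSuccesses hC i₀ t
    (@MeasurableSet.univ Ω (slotSigma U X (t * τ))) B
  simpa using h

/-- The binomial law of a frame holds on every event of its past, and the successes of earlier
frames belong to that past. -/
lemma iIndepFun_frameSuccesses (hC : IsChannel P U X p) (i₀ : Fin N) :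
    iIndepFun (fun t => π.frameSuccesses U X i₀ t) P := by
  refine iIndepFun_of_indep_past (F := fun t => slotSigma U X (t * τ))
    (fun i j hij => slotSigma_mono U X (Nat.mul_le_mul_right τ hij)) (fun t => ?_) fun t => ?_
  · rw [Nat.succ_mul]
    exact π.measurable_successesAt U X i₀ (t * τ) τ
  · rw [Indep_iff]
    rintro _ A ⟨B, -, rfl⟩ hA
    rw [Set.inter_comm, ← ENNReal.toReal_eq_toReal_iff' (measure_ne_top _ _)
      (ENNReal.mul_ne_top (measure_ne_top _ _) (measure_ne_top _ _)), ENNReal.toReal_mul]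
    have h1 := π.measureReal_inter_frameSuccesses hC i₀ t hA B
    have h2 := π.measureReal_frameSuccesses hC i₀ t B
    simp only [measureReal_def] at h1 h2
    rw [h1, h2, mul_comm]

lemma identDistrib_frameSuccesses (hC : IsChannel P U X p) (i₀ : Fin N) (t : ℕ) :
    IdentDistrib (π.frameSuccesses U X i₀ t) (π.frameSuccesses U X i₀ 0) P P := by
  refine ⟨(π.measurable_frameSuccesses hC i₀ t).aemeasurable,
    (π.measurable_frameSuccesses hC i₀ 0).aemeasurable, ?_⟩
  ext B hB
  rw [Measure.map_apply (π.measurable_frameSuccesses hC i₀ t) hB,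
    Measure.map_apply (π.measurable_frameSuccesses hC i₀ 0) hB,
    ← ENNReal.toReal_eq_toReal_iff' (measure_ne_top _ _) (measure_ne_top _ _)]
  exact (π.measureReal_frameSuccesses hC i₀ t B).trans (π.measureReal_frameSuccesses hC i₀ 0 B).symm

end Policy

/-- The increment of the scaled total debt in a frame with `s` successes. -/
noncomputable def frameIncrement (N : ℕ) (p q : ℝ) (s : ℕ) : ℝ := (N * q - min (N : ℝ) s) / p

/-- The standard deviation of the increments of the scaled total debt. -/
noncomputable def frameStd (N τ : ℕ) (p q : ℝ) : ℝ :=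
  Real.sqrt (binomialExp p τ fun s => frameIncrement N p q s ^ 2)

/-- This is the only role of the heavy-traffic equation: it centers the steps. -/
lemma binomialExp_frameIncrement (hp : 0 < p) (hτ : 0 < τ) {q : ℝ}
    (hq : N * (q / p) = τ * (1 - idleFraction N τ p)) :
    binomialExp p τ (frameIncrement N p q) = 0 := by
  have hp' : (0 : ℝ) < p := hp
  have h1 : frameIncrement N p q = fun s : ℕ => N * q / p + (-1 / (p : ℝ)) * min (N : ℝ) s := by
    ext s
    rw [frameIncrement]
    ring
  rw [mul_one_sub_idleFraction N hτ] at hq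
  rw [h1, binomialExp_add, binomialExp_const, binomialExp_const_mul, binomialExp_min_eq hp.ne',
    ← hq]
  field_simp
  ring

lemma frameStd_sq (N τ : ℕ) (p : unitInterval) (q : ℝ) :
    binomialExp p τ (fun s => frameIncrement N p q s ^ 2) = frameStd N τ p q ^ 2 := by
  refine (Real.sq_sqrt ?_).symm
  rw [← binomialExp_const (p := (p : ℝ)) τ 0]
  exact binomialExp_mono p.2.1 p.2.2 τ fun s => sq_nonneg _

lemma abs_frameIncrement_le (N : ℕ) (p q : ℝ) (s : ℕ) :
    |frameIncrement N p q s| ≤ (|N * q| + N) / |p| := by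
  rw [frameIncrement, abs_div]
  gcongr
  exact (abs_sub _ _).trans (add_le_add_right (abs_min_natCast_le (Nat.cast_nonneg s)) _)

namespace Policy

variable [IsProbabilityMeasure P] {π : Policy N τ E}

lemma totalIncrement_eq {Ω : Type*} {U : Ω → E} {X : ℕ → Ω → Fin N → Bool}
    (hπ : π.NonIdling) (hτ : 0 < τ) (i₀ : Fin N) (p q : ℝ) (t : ℕ) (ω : Ω) :
    π.totalIncrement p q U X t ω = frameIncrement N p q (π.frameSuccesses U X i₀ t ω) := by
  have h := sum_debt_history_succ (U ω) (fun n => X n ω) hπ hτ i₀ q t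
  simp only [totalIncrement, ← Finset.sum_div, Finset.sum_sub_distrib, debtAt, h, frameIncrement]
  ring

lemma sum_debtAt_div {Ω : Type*} {U : Ω → E} {X : ℕ → Ω → Fin N → Bool}
    (hπ : π.NonIdling) (hτ : 0 < τ) (i₀ : Fin N) (p q : ℝ) (t : ℕ) (ω : Ω) :
    (∑ j, π.debtAt q U X j t ω) / p =
      ∑ i ∈ Finset.range t, frameIncrement N p q (π.frameSuccesses U X i₀ i ω) := by
  induction t with
  | zero => simp [debtAt, debt, history]
  | succ t ih =>
    rw [Finset.sum_range_succ, ← ih, ← totalIncrement_eq hπ hτ]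
    simp only [totalIncrement, ← Finset.sum_div, Finset.sum_sub_distrib]
    ring

lemma sqrt_variance_totalIncrement (hC : IsChannel P U X p) (hπ : π.NonIdling) (hN : 0 < N)
    (hp : 0 < p) (hτ : 0 < τ) {q : ℝ} (hq : N * (q / p) = τ * (1 - idleFraction N τ p)) (t : ℕ) :
    Real.sqrt (variance (π.totalIncrement p q U X t) P) = frameStd N τ p q := by
  have h1 : π.totalIncrement p q U X t =
      fun ω => frameIncrement N p q (π.frameSuccesses U X ⟨0, hN⟩ t ω) :=
    funext fun ω => totalIncrement_eq hπ hτ _ p q t ω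
  have hm : Measurable fun ω => frameIncrement N p q (π.frameSuccesses U X ⟨0, hN⟩ t ω) :=
    (measurable_from_nat (f := frameIncrement N p q)).comp
      (π.measurable_frameSuccesses hC _ t)
  rw [h1, variance_eq_integral hm.aemeasurable,
    π.integral_frameSuccesses hC _ t (frameIncrement N p q), binomialExp_frameIncrement hp hτ hq]
  simp only [sub_zero]
  rw [π.integral_frameSuccesses hC _ t fun s => frameIncrement N p q s ^ 2, frameStd]

/-- The law of the iterated logarithm for the total debt of a non-idling policy. -/
lemma ae_iterated_logarithm_sum_debtAt (hC : IsChannel P U X p) (hπ : π.NonIdling) (hN : 0 < N)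
    (hp : 0 < p) (hτ : 0 < τ) {q : ℝ} (hq : N * (q / p) = τ * (1 - idleFraction N τ p)) :
    ∀ᵐ ω ∂P, ∀ ε > 0,
      (∀ᶠ t in atTop, (∑ j, π.debtAt q U X j t ω) / p ≤ (frameStd N τ p q + ε) * phi t) ∧
      (∀ᶠ t in atTop, -((frameStd N τ p q + ε) * phi t) ≤ (∑ j, π.debtAt q U X j t ω) / p) ∧
      (∃ᶠ t in atTop, (frameStd N τ p q - ε) * phi t ≤ (∑ j, π.debtAt q U X j t ω) / p) ∧
      (∃ᶠ t in atTop, (∑ j, π.debtAt q U X j t ω) / p ≤ -((frameStd N τ p q - ε) * phi t)) := by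
  simp only [sum_debtAt_div hπ hτ ⟨0, hN⟩]
  refine ae_iterated_logarithm
    (Z := fun t ω => frameIncrement N p q (π.frameSuccesses U X ⟨0, hN⟩ t ω))
    (fun t => (measurable_from_nat (f := frameIncrement N p q)).comp
      (π.measurable_frameSuccesses hC _ t))
    ((π.iIndepFun_frameSuccesses hC ⟨0, hN⟩).comp (fun _ => frameIncrement N p q)
      fun _ => measurable_from_nat)
    (fun t => (π.identDistrib_frameSuccesses hC ⟨0, hN⟩ t).comp
      (measurable_from_nat (f := frameIncrement N p q)))
    (fun _ _ => abs_frameIncrement_le N p q _) ?_ (Real.sqrt_nonneg _) ?_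
  · rw [π.integral_frameSuccesses hC _ 0 (frameIncrement N p q),
      binomialExp_frameIncrement hp hτ hq]
  · rw [π.integral_frameSuccesses hC _ 0 fun s => frameIncrement N p q s ^ 2, frameStd_sq]

end Policy

end Frames

/-! ### State space collapse under MWDF -/

section Collapse

variable {Ω E : Type*} [MeasurableSpace E] {N τ : ℕ}

namespace Policy

variable {π : Policy N τ E}

/-- The deviation ignores the names of the clients, so the debts may be read in the order of
service, where the served clients form an initial segment. -/
lemma sqDev_debt_history_succ (hτ : 0 < τ) {p q : ℝ} (hp : 0 < p) (hπ : π.IsMWDF p q)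
    (i₀ : Fin N) (e : E) (x : ℕ → Fin N → Bool) (t : ℕ) :
    sqDev (debt τ q (π.history e x ((t + 1) * τ))) =
      sqDev (stepDebt q (debt τ q (π.history e x (t * τ)) ∘
        sortDecreasing (debt τ q (π.history e x (t * τ)))) (π.successes e x i₀ (t * τ) τ)) := by
  obtain ⟨order, ho⟩ := hπ
  set h := π.history e x (t * τ) with hh
  have hfs : frameStart τ h = h := by
    have := π.frameStart_history e x (t := t) hτ
    simpa using this
  have hanti : Antitone (debt τ q h ∘ order h e) := fun i j hij => by
    have := (ho h e).1 hij
    simp only [hfs] at this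
    exact (div_le_div_iff_of_pos_right hp).1 this
  rw [← comp_eq_of_antitone hanti (antitone_sortDecreasing _),
    ← sqDev_comp_perm (debt τ q (π.history e x ((t + 1) * τ))) (order h e)]
  congr 1
  ext k
  have hk := mem_delivered_iff e x (fun h e => (ho h e).2) i₀ (t := t) le_rfl k
  simp only [Function.comp_apply, stepDebt, π.debt_history_succ e x hτ, ← hk, ← hh]

variable {U : Ω → E} {X : ℕ → Ω → Fin N → Bool} {p : unitInterval}

variable (π U X) in
/-- The deviation of the debts at the beginning of frame `t`. -/
noncomputable def debtDev (q : ℝ) (t : ℕ) (ω : Ω) : ℝ :=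
  sqDev (debt τ q (π.history (U ω) (fun n => X n ω) (t * τ)))

lemma debtDev_zero (q : ℝ) (ω : Ω) : π.debtDev U X q 0 ω = 0 := by
  simp [debtDev, sqDev, debt, history]

variable [MeasurableSpace Ω] {P : Measure Ω}

/-- A substitute for conditioning: on each of the countably many history events the debts are
constant, while the next frame is still binomial. -/
lemma lintegral_eq_tsum_history (hC : IsChannel P U X p) (n : ℕ) (f : Ω → ENNReal) :
    ∫⁻ ω, f ω ∂P =
      ∑' h, ∫⁻ ω in {ω | π.history (U ω) (fun n => X n ω) n = h}, f ω ∂P := by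
  have hle := slotSigma_le hC.measurable_seed hC.measurable_channel
  rw [← lintegral_iUnion (fun h => hle n _ (π.measurableSet_history_eq U X n h))
    (fun h h' hne => Set.disjoint_left.2 fun ω h1 h2 => hne (by
      simp only [Set.mem_ofPred_eq] at h1 h2; rw [← h1, ← h2]))]
  have : ⋃ h, {ω | π.history (U ω) (fun n => X n ω) n = h} = Set.univ := by
    ext ω; simp
  rw [this, Measure.restrict_univ]

lemma measurable_debtDev (hC : IsChannel P U X p) (q : ℝ) (t : ℕ) :
    Measurable (π.debtDev U X q t) := by
  intro B _
  have h1 : π.debtDev U X q t ⁻¹' B = ⋃ h ∈ {h : History N | sqDev (debt τ q h) ∈ B},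
      {ω | π.history (U ω) (fun n => X n ω) (t * τ) = h} := by
    ext ω; simp [debtDev]
  rw [h1]
  exact MeasurableSet.biUnion (Set.to_countable _) fun h _ =>
    slotSigma_le hC.measurable_seed hC.measurable_channel _ _
      (π.measurableSet_history_eq U X (t * τ) h)

variable [IsProbabilityMeasure P]

lemma lintegral_debtDev_succ_le (hC : IsChannel P U X p) (hN : 0 < N) (hτ : 0 < τ) (hp : 0 < p)
    {q K : ℝ} (hK0 : 0 ≤ K) (hπ : π.IsMWDF p q)
    (hK : ∀ z : Fin N → ℝ, Antitone z →
      binomialExp p τ (fun s => sqDev (stepDebt q z s) ^ 3) ≤ sqDev z ^ 3 + K) (t : ℕ) :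
    ∫⁻ ω, ENNReal.ofReal (π.debtDev U X q (t + 1) ω ^ 3) ∂P ≤
      ∫⁻ ω, ENNReal.ofReal (π.debtDev U X q t ω ^ 3) ∂P + ENNReal.ofReal K := by
  have hle := slotSigma_le hC.measurable_seed hC.measurable_channel
  have hsplit : ∫⁻ ω, ENNReal.ofReal (π.debtDev U X q t ω ^ 3) ∂P + ENNReal.ofReal K =
      ∫⁻ ω, ENNReal.ofReal (π.debtDev U X q t ω ^ 3 + K) ∂P := by
    have h1 : ∀ ω, ENNReal.ofReal (π.debtDev U X q t ω ^ 3 + K) =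
        ENNReal.ofReal (π.debtDev U X q t ω ^ 3) + ENNReal.ofReal K := fun ω =>
      ENNReal.ofReal_add (pow_nonneg (sqDev_nonneg _) 3) hK0
    simp only [h1]
    rw [lintegral_add_right _ measurable_const]
    simp
  rw [hsplit, lintegral_eq_tsum_history (π := π) hC (t * τ),
    lintegral_eq_tsum_history (π := π) hC (t * τ)]
  refine ENNReal.tsum_le_tsum fun h => ?_
  set A := {ω | π.history (U ω) (fun n => X n ω) (t * τ) = h} with hA
  have hAm := π.measurableSet_history_eq U X (t * τ) h
  set z := debt τ q h ∘ sortDecreasing (debt τ q h) with hz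
  set w : ℕ → ℝ := fun s => sqDev (stepDebt q z s) ^ 3 with hw
  set i₀ : Fin N := ⟨0, hN⟩
  have hw0 : ∀ s, 0 ≤ w s := fun s => pow_nonneg (sqDev_nonneg _) 3
  have hVz : sqDev z = sqDev (debt τ q h) := sqDev_comp_perm _ _
  have e1 : ∫⁻ ω in A, ENNReal.ofReal (π.debtDev U X q (t + 1) ω ^ 3) ∂P =
      ∫⁻ ω in A, ENNReal.ofReal (w (π.frameSuccesses U X i₀ t ω)) ∂P := by
    refine setLIntegral_congr_fun (hle _ _ hAm) fun ω hω => ?_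
    have hω : π.history (U ω) (fun n => X n ω) (t * τ) = h := hω
    simp only [debtDev, sqDev_debt_history_succ hτ hp hπ i₀, hω]
    rfl
  have e2 : ∫⁻ ω in A, ENNReal.ofReal (π.debtDev U X q t ω ^ 3 + K) ∂P =
      ∫⁻ _ in A, ENNReal.ofReal (sqDev z ^ 3 + K) ∂P := by
    refine setLIntegral_congr_fun (hle _ _ hAm) fun ω hω => ?_
    have hω : π.history (U ω) (fun n => X n ω) (t * τ) = h := hω
    simp only [debtDev, hω, hVz]
  have hint : Integrable (fun ω => w (π.frameSuccesses U X i₀ t ω)) P := by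
    refine .of_bound ((measurable_from_nat (f := w)).comp
      (π.measurable_frameSuccesses hC i₀ t)).aestronglyMeasurable
      (∑ s ∈ Finset.range (τ + 1), |w s|) (.of_forall fun ω => ?_)
    exact Finset.single_le_sum (f := fun s => |w s|) (fun _ _ => abs_nonneg _)
      (Finset.mem_range.2 (Nat.lt_succ_of_le (π.successes_le i₀ _ _)))
  rw [e1, e2, ← ofReal_integral_eq_lintegral_ofReal hint.integrableOn (.of_forall fun ω => hw0 _),
    π.setIntegral_frameSuccesses hC i₀ t hAm w, setLIntegral_const, mul_comm (ENNReal.ofReal _),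
    ENNReal.ofReal_mul measureReal_nonneg, ofReal_measureReal]
  gcongr
  exact hK z (antitone_sortDecreasing _)

/-- State space collapse: under a maximum weighted debt first policy the deviations of the debts
from their mean are small compared to `√t`. -/
theorem ae_eventually_debtDev_le (hC : IsChannel P U X p) (hN : 0 < N) (hτ : 0 < τ) (hp : 0 < p)
    {q : ℝ} (hπ : π.IsMWDF p q) :
    ∀ᵐ ω ∂P, ∀ ε > 0, ∀ᶠ t : ℕ in atTop, π.debtDev U X q t ω ≤ ε * t := by
  set i₀ : Fin N := ⟨0, hN⟩
  set B : Set ℕ := {s | 0 < s ∧ s < N} with hB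
  have hBi : (B.indicator 1 : ℕ → ℝ) = fun s => if 0 < s ∧ s < N then 1 else 0 := by
    ext s; simp [hB, Set.indicator_apply]
  have hθ0 : 0 ≤ binomialExp p τ fun s => if 0 < s ∧ s < N then 1 else 0 := by
    rw [← hBi, ← π.measureReal_frameSuccesses hC i₀ 0 B]
    exact measureReal_nonneg
  -- If `θ = 0` (for instance `N = 1`) there is no restoring force, but almost surely no frame
  -- separates the clients, so the deviation stays `0`.
  rcases hθ0.eq_or_lt with hθ | hθ
  · have hnull : ∀ᵐ ω ∂P, ∀ t, ¬(0 < π.frameSuccesses U X i₀ t ω ∧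
        π.frameSuccesses U X i₀ t ω < N) := by
      rw [ae_all_iff]
      intro t
      have h1 := π.measureReal_frameSuccesses hC i₀ t B
      rw [hBi, ← hθ, measureReal_eq_zero_iff] at h1
      rw [ae_iff]
      simpa [hB] using h1
    filter_upwards [hnull] with ω hω ε hε
    have hzero : ∀ t, π.debtDev U X q t ω = 0 := by
      intro t
      induction t with
      | zero => exact debtDev_zero q ω
      | succ t ih =>
        rw [debtDev, sqDev_debt_history_succ hτ hp hπ i₀, stepDebt_of_not q _ (hω t) hN,
          sqDev_comp_perm]
        exact ih
    exact .of_forall fun t => by rw [hzero]; positivity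
  · obtain ⟨K, hK0, hK⟩ := exists_binomialExp_sqDev_le hN p.2.1 p.2.2 hθ q
    have hgrow : ∀ t : ℕ, ∫⁻ ω, ENNReal.ofReal (π.debtDev U X q t ω ^ 3) ∂P ≤
        ENNReal.ofReal (K * t) := by
      intro t
      induction t with
      | zero => simp [debtDev_zero]
      | succ t ih =>
        refine (lintegral_debtDev_succ_le hC hN hτ hp hK0 hπ hK t).trans ?_
        rw [Nat.cast_succ, mul_add, mul_one, ENNReal.ofReal_add (by positivity) hK0]
        gcongr
    have hae : ∀ ε : ℝ, 0 < ε → ∀ᵐ ω ∂P, ∀ᶠ t : ℕ in atTop, π.debtDev U X q t ω ≤ ε * t := by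
      intro ε hε
      -- Markov's inequality for the cube gives `K t / (ε t)³`. Linear growth of the second moment
      -- would give only the divergent series of `1 / t`.
      have hsum : Summable fun t : ℕ => K / ε ^ 3 * (1 / (t : ℝ) ^ 2) :=
        (Real.summable_one_div_nat_pow.2 (by norm_num)).mul_left _
      have hbound : ∀ᶠ t : ℕ in atTop, P {ω | ε * t < π.debtDev U X q t ω} ≤
          ENNReal.ofReal (K / ε ^ 3 * (1 / (t : ℝ) ^ 2)) := by
        filter_upwards [eventually_gt_atTop 0] with t ht
        have ht' : (0 : ℝ) < t := by exact_mod_cast ht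
        have h1 : {ω | ε * t < π.debtDev U X q t ω} ⊆
            {ω | ENNReal.ofReal ((ε * t) ^ 3) ≤ ENNReal.ofReal (π.debtDev U X q t ω ^ 3)} :=
          fun ω hω => ENNReal.ofReal_le_ofReal
            (pow_le_pow_left₀ (by positivity) (le_of_lt hω) 3)
        have h2 := meas_ge_le_lintegral_div (μ := P)
          (f := fun ω => ENNReal.ofReal (π.debtDev U X q t ω ^ 3))
          (((measurable_debtDev hC q t).pow_const 3).ennreal_ofReal.aemeasurable)
          (ε := ENNReal.ofReal ((ε * t) ^ 3))
          (ENNReal.ofReal_pos.2 (by positivity)).ne' ENNReal.ofReal_ne_top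
        refine (measure_mono h1).trans (h2.trans ((ENNReal.div_le_div_right (hgrow t) _).trans ?_))
        rw [← ENNReal.ofReal_div_of_pos (by positivity)]
        refine ENNReal.ofReal_le_ofReal (le_of_eq ?_)
        field_simp
      filter_upwards [ae_eventually_notMem_of_summable hsum (fun t => by positivity) hbound]
        with ω hω
      filter_upwards [hω] with t ht
      simpa using ht
    have hall : ∀ᵐ ω ∂P, ∀ k : ℕ, ∀ᶠ t : ℕ in atTop,
        π.debtDev U X q t ω ≤ 1 / ((k : ℝ) + 1) * t :=
      ae_all_iff.2 fun k => hae _ Nat.one_div_pos_of_nat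
    filter_upwards [hall] with ω hω ε hε
    obtain ⟨k, hk⟩ := exists_nat_one_div_lt hε
    filter_upwards [hω k] with t ht
    exact ht.trans (mul_le_mul_of_nonneg_right hk.le (Nat.cast_nonneg t))

end Policy

end Collapse

/-! ### From the total debt to the single debts, and optimality -/

section Main

lemma limsup_coe_eq_of_forall {u : ℕ → ℝ} {c : ℝ} (h1 : ∀ ε > 0, ∀ᶠ t in atTop, u t ≤ c + ε)
    (h2 : ∀ ε > 0, ∃ᶠ t in atTop, c - ε ≤ u t) :
    limsup (fun t => (u t : EReal)) atTop = c := by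
  refine le_antisymm (EReal.le_of_forall_lt_iff_le.1 fun z hz => ?_)
    (EReal.ge_of_forall_gt_iff_ge.1 fun z hz => ?_)
  · have hz' : c < z := EReal.coe_lt_coe_iff.1 hz
    refine limsup_le_of_le (by isBoundedDefault) ?_
    filter_upwards [h1 (z - c) (by linarith)] with t ht
    exact EReal.coe_le_coe_iff.2 (by linarith)
  · have hz' : z < c := EReal.coe_lt_coe_iff.1 hz
    refine le_limsup_of_frequently_le ((h2 (c - z) (by linarith)).mono fun t ht => ?_)
      (by isBoundedDefault)
    exact EReal.coe_le_coe_iff.2 (by linarith)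

lemma liminf_coe_eq_of_forall {u : ℕ → ℝ} {c : ℝ} (h1 : ∀ ε > 0, ∀ᶠ t in atTop, c - ε ≤ u t)
    (h2 : ∀ ε > 0, ∃ᶠ t in atTop, u t ≤ c + ε) :
    liminf (fun t => (u t : EReal)) atTop = c := by
  refine le_antisymm (EReal.le_of_forall_lt_iff_le.1 fun z hz => ?_)
    (EReal.ge_of_forall_gt_iff_ge.1 fun z hz => ?_)
  · have hz' : c < z := EReal.coe_lt_coe_iff.1 hz
    refine liminf_le_of_frequently_le ((h2 (z - c) (by linarith)).mono fun t ht => ?_)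
      (by isBoundedDefault)
    exact EReal.coe_le_coe_iff.2 (by linarith)
  · have hz' : z < c := EReal.coe_lt_coe_iff.1 hz
    refine le_liminf_of_le (by isBoundedDefault) ?_
    filter_upwards [h1 (c - z) (by linarith)] with t ht
    exact EReal.coe_le_coe_iff.2 (by linarith)

/-- Makes errors of order `o(√t)` negligible on the scale `φ(t)`. -/
lemma eventually_sqrt_le_phi : ∀ᶠ t : ℕ in atTop, 0 < phi t ∧ Real.sqrt t ≤ phi t := by
  have h : Tendsto (fun t : ℕ => Real.log (Real.log t)) atTop atTop :=
    Real.tendsto_log_atTop.comp (Real.tendsto_log_atTop.comp tendsto_natCast_atTop_atTop)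
  filter_upwards [h.eventually_ge_atTop 1, eventually_gt_atTop 0] with t ht ht0
  have ht0' : (0 : ℝ) < t := by exact_mod_cast ht0
  have h1 : Real.sqrt t ≤ phi t := Real.sqrt_le_sqrt (by nlinarith)
  exact ⟨(Real.sqrt_pos.2 ht0').trans_le h1, h1⟩

namespace Policy

variable {Ω E : Type*} [MeasurableSpace E] {N τ : ℕ}

lemma exists_isMWDF (N τ : ℕ) (E : Type*) [MeasurableSpace E] {p : ℝ} (hp : 0 < p) (q : ℝ) :
    ∃ π : Policy N τ E, π.IsMWDF p q := by
  refine ⟨⟨fun h _ => (List.ofFn (sortDecreasing (debt τ q (frameStart τ h)))).find?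
    fun i => decide (i ∈ undelivered τ h), fun h a => MeasurableSet.const _, fun h _ i hi => ?_⟩,
    fun h _ => sortDecreasing (debt τ q h), fun h _ => ⟨fun i j hij => ?_, rfl⟩⟩
  · simpa using List.find?_some hi
  · exact div_le_div_of_nonneg_right
      (antitone_sortDecreasing (debt τ q (frameStart τ h)) hij) hp.le

variable [MeasurableSpace Ω] {P : Measure Ω} {U : Ω → E} {X : ℕ → Ω → Fin N → Bool}

/-- The maximum of the `v_j` is at least their average, and their sum is prescribed. -/
lemma div_le_of_mem_costs (hN : 0 < N) {p q σ c : ℝ}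
    (hc : c ∈ costs (E := E) P N τ p q U X σ) : σ / N ≤ c := by
  obtain ⟨π, v, w, h, rfl⟩ := hc
  rw [div_le_iff₀ (by positivity), ← h.sum_v]
  calc ∑ j, v j ≤ ∑ _j : Fin N, ⨆ j, v j :=
        Finset.sum_le_sum fun j _ => le_ciSup (Set.finite_range v).bddAbove j
    _ = (⨆ j, v j) * N := by simp [mul_comm]

variable [IsProbabilityMeasure P] {p : unitInterval} {π : Policy N τ E}

/-- Under a maximum weighted debt first policy every scaled debt fluctuates between `-σ / N` and
`σ / N`. -/
theorem ae_scaledDebt (hC : IsChannel P U X p) (hN : 0 < N) (hτ : 0 < τ) (hp : 0 < p) {q : ℝ}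
    (hq : N * (q / p) = τ * (1 - idleFraction N τ p)) (hπ : π.IsMWDF p q) (j : Fin N) :
    ∀ᵐ ω ∂P, ∀ ε > 0,
      (∀ᶠ t in atTop, π.scaledDebt p q U X j t ω ≤ frameStd N τ p q / N + ε) ∧
      (∀ᶠ t in atTop, -(frameStd N τ p q / N) - ε ≤ π.scaledDebt p q U X j t ω) ∧
      (∃ᶠ t in atTop, frameStd N τ p q / N - ε ≤ π.scaledDebt p q U X j t ω) ∧
      (∃ᶠ t in atTop, π.scaledDebt p q U X j t ω ≤ -(frameStd N τ p q / N) + ε) := by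
  have hp' : (0 : ℝ) < p := hp
  have hN' : (1 : ℝ) ≤ N := by exact_mod_cast hN
  filter_upwards [ae_iterated_logarithm_sum_debtAt hC hπ.nonIdling hN hp hτ hq,
    ae_eventually_debtDev_le hC hN hτ hp hπ] with ω hlil hdev ε hε
  set σ := frameStd N τ p q
  -- Half of `ε` is spent on the total debt, half on the distance of one debt from the mean.
  obtain ⟨h1, h2, h3, h4⟩ := hlil (ε / 2) (by positivity)
  have hclose : ∀ᶠ t in atTop, 0 < phi t ∧
      |π.debtAt q U X j t ω / p - (∑ i, π.debtAt q U X i t ω) / p / N| ≤ ε / 2 * phi t := by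
    filter_upwards [eventually_sqrt_le_phi, hdev ((ε / 2 * p) ^ 2) (by positivity)] with t ht hd
    refine ⟨ht.1, ?_⟩
    have h5 : |π.debtAt q U X j t ω - (∑ i, π.debtAt q U X i t ω) / N| ≤ ε / 2 * p * phi t := by
      calc |π.debtAt q U X j t ω - (∑ i, π.debtAt q U X i t ω) / N|
          ≤ Real.sqrt ((ε / 2 * p) ^ 2 * t) := Real.abs_le_sqrt
            ((sq_sub_mean_le_sqDev (fun i => π.debtAt q U X i t ω) j).trans hd)
        _ = ε / 2 * p * Real.sqrt t := by
            rw [Real.sqrt_mul (sq_nonneg _), Real.sqrt_sq (by positivity)]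
        _ ≤ _ := by gcongr; exact ht.2
    have h6 : π.debtAt q U X j t ω / p - (∑ i, π.debtAt q U X i t ω) / p / N =
        (π.debtAt q U X j t ω - (∑ i, π.debtAt q U X i t ω) / N) / p := by
      field_simp
    rw [h6, abs_div, abs_of_pos hp', div_le_iff₀ hp']
    linarith
  have hdiv : ∀ x : ℝ, 0 ≤ x → x / N ≤ x := fun x hx => div_le_self hx hN'
  have hs : ∀ t, π.scaledDebt p q U X j t ω = π.debtAt q U X j t ω / p / phi t := fun t => by
    rw [scaledDebt]; ring
  have hup : ∀ {t : ℕ} {S x : ℝ}, 0 < phi t → S ≤ x * phi t → S / N ≤ x / N * phi t :=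
    fun _ h => by
      rw [div_mul_eq_mul_div]
      gcongr
  have hlow : ∀ {t : ℕ} {S x : ℝ}, 0 < phi t → x * phi t ≤ S → x / N * phi t ≤ S / N :=
    fun _ h => by
      rw [div_mul_eq_mul_div]
      gcongr
  have hε2 := hdiv (ε / 2) (by positivity)
  refine ⟨?_, ?_, ?_, ?_⟩
  · filter_upwards [h1, hclose] with t ha hb
    rw [hs, div_le_iff₀ hb.1]
    have := hup hb.1 ha
    rw [add_div] at this
    nlinarith [(abs_le.1 hb.2).2, mul_le_mul_of_nonneg_right hε2 hb.1.le]
  · filter_upwards [h2, hclose] with t ha hb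
    rw [hs, le_div_iff₀ hb.1]
    rw [← neg_mul] at ha
    have := hlow hb.1 ha
    rw [neg_div, add_div] at this
    nlinarith [(abs_le.1 hb.2).1, mul_le_mul_of_nonneg_right hε2 hb.1.le]
  · refine (h3.and_eventually hclose).mono fun t ⟨ha, hb⟩ => ?_
    rw [hs, le_div_iff₀ hb.1]
    have := hlow hb.1 ha
    rw [sub_div] at this
    nlinarith [(abs_le.1 hb.2).1, mul_le_mul_of_nonneg_right hε2 hb.1.le]
  · refine (h4.and_eventually hclose).mono fun t ⟨ha, hb⟩ => ?_
    rw [hs, div_le_iff₀ hb.1]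
    rw [← neg_mul] at ha
    have := hup hb.1 ha
    rw [neg_div, sub_div] at this
    nlinarith [(abs_le.1 hb.2).2, mul_le_mul_of_nonneg_right hε2 hb.1.le]

lemma ae_limsup_scaledDebt (hC : IsChannel P U X p) (hN : 0 < N) (hτ : 0 < τ) (hp : 0 < p) {q : ℝ}
    (hq : N * (q / p) = τ * (1 - idleFraction N τ p)) (hπ : π.IsMWDF p q) (j : Fin N) :
    ∀ᵐ ω ∂P, limsup (fun t => ((π.scaledDebt p q U X j t ω : ℝ) : EReal)) atTop =
      ((frameStd N τ p q / N : ℝ) : EReal) := by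
  filter_upwards [ae_scaledDebt hC hN hτ hp hq hπ j] with ω hω
  exact limsup_coe_eq_of_forall (fun ε hε => (hω ε hε).1) fun ε hε => (hω ε hε).2.2.1

lemma inClass_of_isMWDF (hC : IsChannel P U X p) (hN : 0 < N) (hτ : 0 < τ) (hp : 0 < p) {q : ℝ}
    (hq : N * (q / p) = τ * (1 - idleFraction N τ p)) (hπ : π.IsMWDF p q) :
    π.InClass P p q U X (frameStd N τ p q) (fun _ => frameStd N τ p q / N)
      (fun _ => -(frameStd N τ p q / N)) where
  finite_limsup j := by
    filter_upwards [ae_scaledDebt hC hN hτ hp hq hπ j] with ω hω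
    refine lt_of_le_of_lt (limsup_le_of_le (by isBoundedDefault) ?_)
      (EReal.coe_lt_top (frameStd N τ p q / N + 1))
    filter_upwards [(hω 1 one_pos).1, (hω 1 one_pos).2.1] with t h1 h2
    exact EReal.coe_le_coe_iff.2 (abs_le.2 ⟨by linarith, h1⟩)
  limsup_eq := ae_limsup_scaledDebt hC hN hτ hp hq hπ
  liminf_eq j := by
    filter_upwards [ae_scaledDebt hC hN hτ hp hq hπ j] with ω hω
    exact liminf_coe_eq_of_forall (fun ε hε => (hω ε hε).2.1) fun ε hε => (hω ε hε).2.2.2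
  sum_v := by
    have : (N : ℝ) ≠ 0 := by positivity
    simp
    field_simp
  sum_w := by
    have : (N : ℝ) ≠ 0 := by positivity
    simp
    field_simp

end Policy

end Main

end RealTimeScheduling

theorem mainTheorem1 {Ω E : Type*} [MeasurableSpace Ω] [MeasurableSpace E]
    (P : MeasureTheory.Measure Ω) [MeasureTheory.IsProbabilityMeasure P]
    (N τ : ℕ) (hN : 0 < N) (hτ : 0 < τ) (p : unitInterval) (hp : 0 < p) (q : ℝ)
    -- channel states: `X n ω i` tells whether a transmission to client `i` in slot `n` succeeds
    (X : ℕ → Ω → Fin N → Bool) (hXm : ∀ n, Measurable (X n))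
    (hXi : ProbabilityTheory.iIndepFun X P)
    (hXp : ∀ n i, P {ω | X n ω i = true} = ENNReal.ofReal p)
    -- random seed of the policies, independent of the channel
    (U : Ω → E) (hUm : Measurable U)
    (hUX : ProbabilityTheory.IndepFun U (fun ω n => X n ω) P)
    -- heavy traffic
    (hq : N * (q / p) = τ * (1 - RealTimeScheduling.idleFraction N τ p)) :
    ∃ σ : ℝ,
      -- `σ` is the common standard deviation of the increments under non-idling policies
      (∀ π : RealTimeScheduling.Policy N τ E, π.NonIdling → ∀ t : ℕ,
        Real.sqrt (ProbabilityTheory.variance (π.totalIncrement p q U X t) P) = σ) ∧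
      (∃ π : RealTimeScheduling.Policy N τ E, π.IsMWDF p q) ∧
      ∀ π : RealTimeScheduling.Policy N τ E, π.IsMWDF p q →
        π.NonIdling ∧
        (∀ j, ∀ᵐ ω ∂P, Filter.limsup (fun t => ((π.scaledDebt p q U X j t ω : ℝ) : EReal))
          Filter.atTop = ((σ / N : ℝ) : EReal)) ∧
        ∃ v w : Fin N → ℝ, π.InClass P p q U X σ v w ∧ (⨆ j, v j) = σ / N ∧
          IsLeast (RealTimeScheduling.Policy.costs P N τ p q U X σ) (⨆ j, v j) := by
  have hC : RealTimeScheduling.IsChannel P U X p := ⟨hUm, hXm, hXi, hXp, hUX⟩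
  have : Nonempty (Fin N) := ⟨⟨0, hN⟩⟩
  refine ⟨RealTimeScheduling.frameStd N τ p q, fun π hπ t =>
    RealTimeScheduling.Policy.sqrt_variance_totalIncrement hC hπ hN hp hτ hq t,
    RealTimeScheduling.Policy.exists_isMWDF N τ E hp q, fun π hπ => ⟨hπ.nonIdling,
    RealTimeScheduling.Policy.ae_limsup_scaledDebt hC hN hτ hp hq hπ, _, _,
    RealTimeScheduling.Policy.inClass_of_isMWDF hC hN hτ hp hq hπ, ciSup_const,
    ⟨π, _, _, RealTimeScheduling.Policy.inClass_of_isMWDF hC hN hτ hp hq hπ, rfl⟩,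
    fun c hc => ?_⟩⟩
  rw [ciSup_const]
  exact RealTimeScheduling.Policy.div_le_of_mem_costs hN hc
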